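/- Throughout, $n\ge 1$, $\mathbb R^n$ carries Lebesgue measure, and the support of a tempered distribution is the complement of the largest open set on which it vanishes. Put $c_-(z)=c(z)c(0)^{-1}=\frac{1+z}{1-z}$, where $c(z)=\frac{z+1}{z-1}$. If $x$ lies in a Cartan subalgebra $\mathfrak h\cong\mathbb R^n$ with coordinate forms $e_k$, $e_k(x)=ix_k$, put $c_-(x)^{\mu}=\prod_k c_-(ix_k)^{\mu_k}$ (principal powers). In each case $B$ denotes the invariant form $B(x,y)=\kappa\,\mathrm{Re}\,\mathrm{tr}(xy)$ on $\mathfrak h$ with an arbitrary fixed normalization $\kappa>0$. The symbol $y\mapsto\int_{\mathfrak h}F(x)e^{iB(x,y)}dx$ denotes the distribution $\varphi\mapsto\int_{\mathfrak h}F(x)\int_{\mathfrak h}e^{iB(x,y)}\varphi(y)\,dy\,dx$ on Schwartz functions; part of the claim is that the outer integral converges absolutely and that this is a tempered distribution. For a real sequence $\mu'_1,\dots,\mu'_n$ and a threshold $t$ let $$\ell(t)=\begin{cases}\max\{j\ge1:\mu'_j\le -t\}&\text{if }\mu'_1\le -t\\0&\text{otherwise}\end{cases},\qquad r(t)=\begin{cases}\min\{j\ge1:\mu'_j\ge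 t\}-1&\text{if }\mu'_n\ge t\\ n&\text{otherwise}\end{cases},$$ and for integers $a\le b$ let $C(a,b)=\{y\in\mathbb R^n: y_k\ge0\ (k\le a),\ y_k=0\ (a<k\le b),\ y_k\le0\ (k>b)\}$. **(1) The pair $(U(n),U(p,q))$, $n\le p+q$.** Let $\mathfrak h=\{\sum_k ix_kE_{kk}\}$, $\mathrm{ch}(x)=|\det_{\mathbb R}(x-1)|^{1/2}$. Let $\nu=\sum_a(\frac{q-p}{2}+\nu_a)e_a$, where $\nu_1\ge\dots\ge\nu_n$ are integers, at most $q$ of them positive and at most $p$ negative (these are the highest weights of the representations of $\widetilde{U(n)}$ in the Howe correspondence). Let $\rho$ be half the sum of the roots $e_i-e_j$ $(i<j)$, let $\mu=\nu+\rho$ and $\mu'_k=\mu_{n+1-k}$, and put $m_{\min}=\ell(\frac{p+q-n+1}{2})$, $m_{\max}=r(\frac{p+q-n+1}{2})$. Let $V=V_0\oplus V_1=\mathbb C^n\oplus\mathbb C^{p+q}$ with bases $(v_k)$, $(w_k)$, and let $b=b_0\oplus b_1$ be the sesquilinear form, conjugate-linear in the first variable, with matrices $b_0=\mathrm{Id}_n$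 and $b_1=i\,\mathrm{Id}_{p,q}$. Let $s=1$ on $V_0$, $s=-1$ on $V_1$, and let $\mathfrak s(V,b)_1$ be the space of odd endomorphisms $X$ with $b(Xu,v)=b(u,sXv)$. For $\max(n-q,0)\le m\le\min(p,n)$ let $\mathfrak h_{1,m}\subset\mathfrak s(V,b)_1$ be the real span of the elements $u_1,\dots,u_n$, where $u_j$ kills all basis vectors except two, which it exchanges up to a phase: $v_j\mapsto e^{i\pi/4}w_j$, $w_j\mapsto e^{i\pi/4}v_j$ if $j\le m$, and $v_j\mapsto e^{-i\pi/4}w_{p+q-n+j}$, $w_{p+q-n+j}\mapsto e^{-i\pi/4}v_j$ if $j>m$. Let $\tau(w)=w^2|_{V_0}$. Then $\max(n-q,0)\le m_{\min}\le m_{\max}\le\min(p,n)$, and $$\mathrm{supp}\int_{\mathfrak h}c_-(x)^{-\mu'}\mathrm{ch}(x)^{p+q-n-1}e^{iB(x,y)}dx=\bigcap_{m'=m_{\min}}^{m_{\max}}\tau(\mathfrak h_{1,m'})=\Big\{\sum_k iy_kE_{kk}: y\in C(m_{\min},m_{\max})\Big\}.$$ In (2)–(4), $n\le m$, $\nu_1\ge\dots\ge\nu_n\ge0$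 are integers, $\nu=\sum_a\nu_ae_a$, $\mu=\nu+\rho$, $\mu'_k=\mu_{n+1-k}$. **(2) The pair $(O(2n),Sp(2m))$.** Let $\mathfrak h=\{\sum_k x_kH_k\}$, $H_k=E_{2k,2k-1}-E_{2k-1,2k}$, $\rho=\frac12\sum_{i<j}\big((e_i-e_j)+(e_i+e_j)\big)$, $\mathrm{ch}(x)=|\det(x-1)|^{1/2}$, $t=m-n+1$. Then the support of $\int_{\mathfrak h}c_-(x)^{-\mu'}\mathrm{ch}(x)^{2m-2n}e^{iB(x,y)}dx$ is $\{\sum_k y_kH_k:y\in C(\ell(t),r(t))\}$. **(3) The pair $(O(2n+1),Sp(2m))$.** With the same $H_k$ (in size $2n+1$), $\rho=\frac12\sum_{i<j}\big((e_i-e_j)+(e_i+e_j)\big)+\frac12\sum_ie_i$, $\mathrm{ch}(x)=|\det(x-1)|^{1/2}$, $t=m-n+\frac12$: the support of $\int_{\mathfrak h}c_-(x)^{-\mu'}\mathrm{ch}(x)^{2m-2n-1}e^{iB(x,y)}dx$ is $\{\sum_k y_kH_k:y\in C(\ell(t),r(t))\}$. **(4) The pair $(U(n,\mathbb H),O^*(m,\mathbb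 H))$.** Let $\mathfrak h=\{\sum_k ix_kE_{kk}\}$ (quaternionic matrices), $\rho=\frac12\sum_{i<j}\big((e_i-e_j)+(e_i+e_j)\big)+\sum_ie_i$, $\mathrm{ch}(x)=|\det_{\mathbb R}(x-1)|^{1/2}$ (real $4n\times4n$ determinant), $t=m-n$. Then the support of $\int_{\mathfrak h}c_-(x)^{-\mu'}\mathrm{ch}(x)^{m-n-1}e^{iB(x,y)}dx$ is $\{\sum_k iy_kE_{kk}:y\in C(\ell(t),r(t))\}$. -/

import Mathlib

open scoped SchwartzMap Quaternion ComplexConjugate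
open MeasureTheory

namespace SupportProp

noncomputable section

/-! ### Common notions -/

/-- The real coordinate space of the Cartan subalgebra (Lebesgue measure is `volume`). -/
abbrev Coord (n : ℕ) : Type := EuclideanSpace ℝ (Fin n)

/-- The tempered distribution `u` on `ℝⁿ` is `y ↦ ∫ F(x) e^{i B(x,y)} dx`, i.e.
`u(φ) = ∫ F(x) (∫ e^{i B(x,y)} φ(y) dy) dx` (a convergent integral) for every Schwartz
function `φ`. -/
def IsOscillatoryIntegral {n : ℕ} (F : Coord n → ℂ) (B : Coord n → Coord n → ℝ)
    (u : 𝓢'(Coord n, ℂ)) : Prop :=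
  ∀ φ : 𝓢(Coord n, ℂ),
    Integrable (fun x => F x * ∫ y, Complex.exp (Complex.I * (B x y : ℂ)) * φ y) ∧
    u φ = ∫ x, F x * ∫ y, Complex.exp (Complex.I * (B x y : ℂ)) * φ y

/-- The modified Cayley transform `c₋(z) = c(z) c(0)⁻¹`, where `c(z) = (z + 1) / (z - 1)`. -/
def cMinus (z : ℂ) : ℂ := ((z + 1) / (z - 1)) * ((0 + 1) / (0 - 1))⁻¹

/-- `c₋(x)^μ = ∏ₖ c₋(eₖ(x))^{μₖ}`, where `e k` is the (purely imaginary) value `eₖ(x)`. On the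
imaginary axis `c₋` takes values in the unit circle without `-1`, and the principal power is the
composite of the character with differential `μ` and the continuous lift of `c₋` with
`c₋(0) = 1`. -/
def cMinusPow {n : ℕ} (e : Fin n → ℂ) (μ : Fin n → ℝ) : ℂ :=
  ∏ k, cMinus (e k) ^ ((μ k : ℝ) : ℂ)

/-- `max {j ≥ 1 : μ'ⱼ ≤ -t}` if `μ'₁ ≤ -t`, and `0` otherwise (indices `j` start at `1`). -/
def lowIdx {n : ℕ} [NeZero n] (t : ℝ) (μ' : Fin n → ℝ) : ℕ :=
  open Classical in
  if μ' 0 ≤ -t then sSup {j : ℕ | ∃ i : Fin n, j = (i : ℕ) + 1 ∧ μ' i ≤ -t} else 0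

/-- `min {j ≥ 1 : μ'ⱼ ≥ t} - 1` if `μ'ₙ ≥ t`, and `n` otherwise (indices `j` start at `1`). -/
def highIdx {n : ℕ} [NeZero n] (t : ℝ) (μ' : Fin n → ℝ) : ℕ :=
  open Classical in
  if t ≤ μ' (Fin.rev 0) then sInf {j : ℕ | ∃ i : Fin n, j = (i : ℕ) + 1 ∧ t ≤ μ' i} - 1 else n

/-- The coordinate form `eₖ`, as a vector. -/
def eVec {n : ℕ} (k : Fin n) : Fin n → ℝ := Pi.single k 1

/-- The embedding `A + iB ↦ [[A, -B], [B, A]]` of complex matrices into real matrices. -/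
def realify {ι : Type*} (X : Matrix ι ι ℂ) : Matrix (ι ⊕ ι) (ι ⊕ ι) ℝ :=
  Matrix.fromBlocks (X.map Complex.re) (-(X.map Complex.im)) (X.map Complex.im) (X.map Complex.re)

/-- The reversed sequence `μ'ₖ = μ_{n+1-k}`. -/
def reversed {n : ℕ} (μ : Fin n → ℝ) : Fin n → ℝ := fun k => μ (Fin.rev k)

/-- The points of `ℝⁿ` whose first `r` coordinates are `≥ 0`, whose coordinates number `k` with
`r < k ≤ s` vanish, and whose remaining coordinates are `≤ 0`. -/
def signCone (n r s : ℕ) : Set (Coord n) :=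
  {y | ∀ k : Fin n, ((k : ℕ) < r → 0 ≤ y k) ∧ (r ≤ (k : ℕ) ∧ (k : ℕ) < s → y k = 0) ∧
    (s ≤ (k : ℕ) → y k ≤ 0)}

/-! ### The pair `(U(n), U(p,q))` -/

namespace Unitary

/-- The matrix `∑ₖ i xₖ Eₖₖ` of the diagonal Cartan subalgebra `𝔥`. -/
def cartan {n : ℕ} (x : Coord n) : Matrix (Fin n) (Fin n) ℂ :=
  Matrix.diagonal fun k => Complex.I * (x k : ℂ)

/-- Half the sum of the positive roots `eᵢ - eⱼ`, `i < j`. -/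
def rho (n : ℕ) : Fin n → ℝ :=
  (1 / 2 : ℝ) • ∑ i : Fin n, ∑ j ∈ Finset.Ioi i, (eVec i - eVec j)

/-- `ν = ∑ₐ ((q - p)/2 + νₐ) eₐ` with `ν₁ ≥ … ≥ νₙ` integers, at most `q` of them positive and at
most `p` of them negative. -/
def IsWeight {n : ℕ} (p q : ℕ) (ν : Fin n → ℤ) : Prop :=
  Antitone ν ∧ (Finset.univ.filter fun a => 0 < ν a).card ≤ q ∧
    (Finset.univ.filter fun a => ν a < 0).card ≤ p

/-- `μ'`, the reverse of `μ = ν + ρ`. -/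
def muPrime {n : ℕ} (p q : ℕ) (ν : Fin n → ℤ) : Fin n → ℝ :=
  reversed fun a => (((q : ℝ) - p) / 2 + ν a) + rho n a

/-- `ch(X) = |det_ℝ(X - 1)|^{1/2}`. -/
def ch {n : ℕ} (X : Matrix (Fin n) (Fin n) ℂ) : ℝ := Real.sqrt |(realify (X - 1)).det|

/-- The function `c₋(x)^{-μ'} ch(x)^{p+q-n-1}`; here `eₖ(X) = Xₖₖ`. -/
def kernel {n : ℕ} (p q : ℕ) (ν : Fin n → ℤ) (x : Coord n) : ℂ :=
  cMinusPow (fun k => cartan x k k) (-muPrime p q ν) *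
    ((ch (cartan x) ^ ((p : ℤ) + q - n - 1) : ℝ) : ℂ)

/-- The invariant form `κ Re tr(XY)` on `𝔥`. -/
def form {n : ℕ} (κ : ℝ) (x y : Coord n) : ℝ := κ * (cartan x * cartan y).trace.re

/-- `(p + q - n + 1) / 2`. -/
def threshold (n p q : ℕ) : ℝ := ((p : ℝ) + q - n + 1) / 2

/-- `m_min`. -/
def mMin {n : ℕ} [NeZero n] (p q : ℕ) (ν : Fin n → ℤ) : ℕ :=
  lowIdx (threshold n p q) (muPrime p q ν)

/-- `m_max`. -/
def mMax {n : ℕ} [NeZero n] (p q : ℕ) (ν : Fin n → ℤ) : ℕ :=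
  highIdx (threshold n p q) (muPrime p q ν)

/-- Matrices of the endomorphisms of `V = V₀ ⊕ V₁ = ℂⁿ ⊕ ℂ^{p+q}`. -/
abbrev EndV (n p q : ℕ) : Type :=
  Matrix (Fin n ⊕ Fin (p + q)) (Fin n ⊕ Fin (p + q)) ℂ

/-- The matrix of `b = b₀ ⊕ b₁`: `b₀` is the identity and `b₁` is `i Id_{p,q}`. -/
def formMat (n p q : ℕ) : EndV n p q :=
  Matrix.fromBlocks 1 0 0 (Matrix.diagonal fun k => if (k : ℕ) < p then Complex.I else -Complex.I)

/-- The sesquilinear form `b(u, v)`, conjugate-linear in the first variable. -/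
def b (n p q : ℕ) (u v : Fin n ⊕ Fin (p + q) → ℂ) : ℂ :=
  star u ⬝ᵥ (formMat n p q).mulVec v

/-- The grading operator `s(u₀ + u₁) = u₀ - u₁`. -/
def grading (n p q : ℕ) : EndV n p q := Matrix.fromBlocks 1 0 0 (-1)

/-- The odd part `𝔰(V, b)₁`: odd endomorphisms `X` with `b(Xu, v) = b(u, sXv)`. -/
def IsOdd {n p q : ℕ} (X : EndV n p q) : Prop :=
  X.toBlocks₁₁ = 0 ∧ X.toBlocks₂₂ = 0 ∧
    ∀ u v, b n p q (X.mulVec u) v = b n p q u ((grading n p q * X).mulVec v)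

/-- The position (counted from `0`) of the basis vector of `V₁` that is paired with the basis
vector number `j` (counted from `0`) of `V₀`: the first `m` are paired with the first `m` vectors
and the others with the last `n - m` ones. -/
def pos (n p q m j : ℕ) : ℕ := if j < m then j else p + q - n + j

/-- The scalar `e^{iπ/4}` for the first `m` indices, `e^{-iπ/4}` for the others. -/
def phase (m j : ℕ) : ℂ :=
  if j < m then Complex.exp (Complex.I * (Real.pi / 4)) else Complex.exp (-(Complex.I * (Real.pi / 4)))

/-- The block `V₁ → V₀` of `uⱼ`. -/
def uBlock {n : ℕ} (p q m : ℕ) (j : Fin n) : Matrix (Fin n) (Fin (p + q)) ℂ :=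
  Matrix.of fun i k => if i = j ∧ (k : ℕ) = pos n p q m j then phase m j else 0

/-- The element `uⱼ`, which exchanges (up to the phase) the vector `vⱼ` of `V₀` with the vector of
`V₁` paired with it and kills all other basis vectors. -/
def u {n : ℕ} (p q m : ℕ) (j : Fin n) : EndV n p q :=
  Matrix.fromBlocks 0 (uBlock p q m j) (uBlock p q m j).transpose 0

open Matrix in
/-- The elements `uⱼ` belong to `𝔰(V, b)₁` for `max(n - q, 0) ≤ m ≤ min(p, n)`. -/
theorem isOdd_u (n p q m : ℕ) (hn : n ≤ p + q) (h1' : n ≤ m + q) (h2 : m ≤ p) (j : Fin n) :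
    IsOdd (u p q m j) := by
  have hc : Complex.exp (Complex.I * (Real.pi / 4)) =
      Complex.I * Complex.exp (-(Complex.I * (Real.pi / 4))) := by
    nth_rw 2 [← Complex.exp_pi_div_two_mul_I]
    rw [← Complex.exp_add]; congr 1; ring
  have hc1 : star (Complex.exp (Complex.I * (Real.pi / 4))) =
      Complex.exp (-(Complex.I * (Real.pi / 4))) := by
    rw [Complex.star_def, ← Complex.exp_conj]; congr 1
    simp [Complex.conj_ofReal, show (starRingEnd ℂ) (4:ℂ) = 4 from Complex.conj_ofNat 4]
  have hc2 : star (Complex.exp (-(Complex.I * (Real.pi / 4)))) =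
      Complex.exp (Complex.I * (Real.pi / 4)) := by
    rw [← hc1, star_star]
  have key : (u p q m j)ᴴ * formMat n p q = formMat n p q * (grading n p q * u p q m j) := by
    simp only [u, formMat, grading, fromBlocks_conjTranspose, fromBlocks_multiply]
    simp only [Matrix.zero_mul, Matrix.mul_zero, Matrix.one_mul, Matrix.mul_one, add_zero, zero_add,
      conjTranspose_zero, neg_mul, neg_zero]
    congr 1
    · ext i k
      simp only [conjTranspose_apply, transpose_apply, mul_diagonal, uBlock, of_apply]
      by_cases h : i = j ∧ (k : ℕ) = pos n p q m j
      · obtain ⟨hi, hk⟩ := h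
        simp only [hi, hk, pos, phase]
        by_cases hj : (j : ℕ) < m
        · simp only [hj, if_true, and_self]
          rw [if_pos (by omega), hc1, hc, mul_comm]
        · simp only [hj, if_false, and_self, if_true]
          rw [if_neg (by have := j.2; omega), hc2, hc]
          linear_combination (-Complex.exp (-(Complex.I * (Real.pi / 4)))) * Complex.I_mul_I
      · simp [h]
    · ext k i
      simp only [conjTranspose_apply, transpose_apply, diagonal_mul, Matrix.neg_mul,
        Matrix.one_mul, Matrix.neg_apply, uBlock, of_apply]
      by_cases h : i = j ∧ (k : ℕ) = pos n p q m j
      · obtain ⟨hi, hk⟩ := h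
        simp only [hi, hk, pos, phase]
        by_cases hj : (j : ℕ) < m
        · simp only [hj, if_true, and_self]
          rw [if_pos (by omega), hc1, hc]
          linear_combination (Complex.exp (-(Complex.I * (Real.pi / 4)))) * Complex.I_mul_I
        · simp only [hj, if_false, and_self, if_true]
          rw [if_neg (by have := j.2; omega), hc2, hc]
          ring
      · simp [h]
  refine ⟨by simp [u], by simp [u], fun x y => ?_⟩
  simp only [b, star_mulVec, ← dotProduct_mulVec, mulVec_mulVec, key]

/-- `𝔥_{1,m} = ∑ⱼ ℝ uⱼ`. -/
def h1 (n p q m : ℕ) : Submodule ℝ (EndV n p q) :=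
  Submodule.span ℝ (Set.range fun j : Fin n => u p q m j)

/-- The moment map `τ(w) = w²|_{V₀}`. -/
def tau {n p q : ℕ} (w : EndV n p q) : Matrix (Fin n) (Fin n) ℂ := (w * w).toBlocks₁₁

end Unitary

/-! ### The pairs `(O(2n), Sp(2m))` and `(O(2n+1), Sp(2m))` -/

namespace Orthogonal

/-- The matrix `∑ₖ xₖ Hₖ`, `Hₖ = E_{2k,2k-1} - E_{2k-1,2k}`, of the Cartan subalgebra of
`𝔬(2n)`; the index `(a, k)` stands for the basis vector number `2k - 1 + a`, `a = 0, 1`. -/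
def cartanEven {n : ℕ} (x : Coord n) : Matrix (Fin 2 × Fin n) (Fin 2 × Fin n) ℝ :=
  Matrix.blockDiagonal fun k => x k • !![0, -1; 1, 0]

/-- The same element in `𝔬(2n+1)`. -/
def cartanOdd {n : ℕ} (x : Coord n) :
    Matrix ((Fin 2 × Fin n) ⊕ Unit) ((Fin 2 × Fin n) ⊕ Unit) ℝ :=
  Matrix.fromBlocks (cartanEven x) 0 0 0

/-- Half the sum of the positive roots `eᵢ ± eⱼ`, `i < j`. -/
def rhoEven (n : ℕ) : Fin n → ℝ :=
  (1 / 2 : ℝ) • ∑ i : Fin n, ∑ j ∈ Finset.Ioi i, ((eVec i - eVec j) + (eVec i + eVec j))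

/-- Half the sum of the positive roots `eᵢ ± eⱼ`, `i < j`, and `eᵢ`. -/
def rhoOdd (n : ℕ) : Fin n → ℝ := rhoEven n + (1 / 2 : ℝ) • ∑ i : Fin n, eVec i

/-- `μ'` for `O(2n)`. -/
def muPrimeEven {n : ℕ} (ν : Fin n → ℕ) : Fin n → ℝ := reversed fun a => (ν a : ℝ) + rhoEven n a

/-- `μ'` for `O(2n+1)`. -/
def muPrimeOdd {n : ℕ} (ν : Fin n → ℕ) : Fin n → ℝ := reversed fun a => (ν a : ℝ) + rhoOdd n a

/-- `ch(X) = |det(X - 1)|^{1/2}`. -/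
def ch {ι : Type*} [Fintype ι] [DecidableEq ι] (X : Matrix ι ι ℝ) : ℝ := Real.sqrt |(X - 1).det|

/-- The linear form `eₖ(X) = -i X_{2k-1,2k}`, so that `eₖ(∑ xₖ Hₖ) = i xₖ`. -/
def e {n : ℕ} (X : Matrix (Fin 2 × Fin n) (Fin 2 × Fin n) ℝ) (k : Fin n) : ℂ :=
  -Complex.I * (X (0, k) (1, k) : ℂ)

/-- `c₋(x)^{-μ'} ch(x)^{2m-2n}`. -/
def kernelEven {n : ℕ} (m : ℕ) (ν : Fin n → ℕ) (x : Coord n) : ℂ :=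
  cMinusPow (e (cartanEven x)) (-muPrimeEven ν) *
    ((ch (cartanEven x) ^ (2 * (m : ℤ) - 2 * n) : ℝ) : ℂ)

/-- `c₋(x)^{-μ'} ch(x)^{2m-2n-1}`. -/
def kernelOdd {n : ℕ} (m : ℕ) (ν : Fin n → ℕ) (x : Coord n) : ℂ :=
  cMinusPow (e (cartanOdd x).toBlocks₁₁) (-muPrimeOdd ν) *
    ((ch (cartanOdd x) ^ (2 * (m : ℤ) - 2 * n - 1) : ℝ) : ℂ)

/-- The invariant form `κ tr(XY)` on the Cartan subalgebra of `𝔬(2n)`. -/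
def formEven {n : ℕ} (κ : ℝ) (x y : Coord n) : ℝ := κ * (cartanEven x * cartanEven y).trace

/-- The invariant form `κ tr(XY)` on the Cartan subalgebra of `𝔬(2n+1)`. -/
def formOdd {n : ℕ} (κ : ℝ) (x y : Coord n) : ℝ := κ * (cartanOdd x * cartanOdd y).trace

end Orthogonal

/-! ### The pair `(U(n, ℍ), O*(m, ℍ))` -/

namespace Quaternionic

/-- The quaternionic matrix `∑ₖ i xₖ Eₖₖ`. -/
def cartan {n : ℕ} (x : Coord n) : Matrix (Fin n) (Fin n) ℍ[ℝ] :=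
  Matrix.diagonal fun k => ⟨0, x k, 0, 0⟩

/-- The complex number `α` in `z = α + jβ`. -/
def alpha (z : ℍ[ℝ]) : ℂ := ⟨z.re, z.imI⟩

/-- The complex number `β` in `z = α + jβ`. -/
def beta (z : ℍ[ℝ]) : ℂ := ⟨z.imJ, -z.imK⟩

/-- The embedding of quaternionic matrices into complex matrices that is induced by
`α + jβ ↦ [[α, -β̄], [β, ᾱ]]`. -/
def complexify {ι : Type*} (X : Matrix ι ι ℍ[ℝ]) : Matrix (ι ⊕ ι) (ι ⊕ ι) ℂ :=
  Matrix.fromBlocks (X.map alpha) (X.map fun z => -conj (beta z)) (X.map beta)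
    (X.map fun z => conj (alpha z))

/-- `ch(X) = |det_ℝ(X - 1)|^{1/2}`, with the determinant of the real `4n × 4n` matrix. -/
def ch {n : ℕ} (X : Matrix (Fin n) (Fin n) ℍ[ℝ]) : ℝ :=
  Real.sqrt |(realify (complexify (X - 1))).det|

/-- Half the sum of the positive roots `eᵢ ± eⱼ`, `i < j`, and `2eᵢ`. -/
def rho (n : ℕ) : Fin n → ℝ :=
  (1 / 2 : ℝ) • ((∑ i : Fin n, ∑ j ∈ Finset.Ioi i, ((eVec i - eVec j) + (eVec i + eVec j))) +
    ∑ i : Fin n, (2 : ℝ) • eVec i)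

/-- `μ'` for `U(n, ℍ)`. -/
def muPrime {n : ℕ} (ν : Fin n → ℕ) : Fin n → ℝ := reversed fun a => (ν a : ℝ) + rho n a

/-- `c₋(x)^{-μ'} ch(x)^{m-n-1}`; here `eₖ(∑ i xₖ Eₖₖ) = i xₖ`. -/
def kernel {n : ℕ} (m : ℕ) (ν : Fin n → ℕ) (x : Coord n) : ℂ :=
  cMinusPow (fun k => alpha (cartan x k k)) (-muPrime ν) *
    ((ch (cartan x) ^ ((m : ℤ) - n - 1) : ℝ) : ℂ)

/-- The invariant form `κ Re tr(XY)`. -/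
def form {n : ℕ} (κ : ℝ) (x y : Coord n) : ℝ := κ * (cartan x * cartan y).trace.re

end Quaternionic

end

end SupportProp

/-! On the imaginary axis c₋(ix) = (1+ix)/(1-ix) and ch(x) is a power of ∏ √(1+xₖ²). So in all four
cases the kernel is ∏ₖ (1+ixₖ)^{aₖ} (1-ixₖ)^{bₖ} with aₖ = D/2 - μ'ₖ and bₖ = D/2 + μ'ₖ, where D is
the resulting exponent of √(1+xₖ²). Both exponents are integers.

After rescaling, these factors are the Fourier symbols of 1 ± v∂ₖ. By Fourier inversion at the
origin, pairing the integral with φ gives a nonzero constant times the value at 0 of ∏ₖ (1+v∂ₖ)^{aₖ}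
(1-v∂ₖ)^{bₖ} φ. Nonnegative powers are differential operators, hence local. The inverse of 1 ± v∂ₖ
integrates against a decaying exponential along a ray, so it looks in one direction only. With v >
0, the k-th factor has support {0} if aₖ, bₖ ≥ 0, the half line y ≥ 0 if only bₖ < 0, and y ≤ 0 if
only aₖ < 0; both exponents are never negative together.

The upper bound on the support holds because the operators preserve vanishing on suitable half
spaces (`integral_coordSymbol_eq_zero`). The lower bound comes from one-dimensional test functions
(`exists_test_line`), multiplied over the coordinates. Since μ' is increasing, the signs of aₖ and
bₖ change at the indices `lowIdx` and `highIdx` for the threshold D/2 + 1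
(`exists_isOscillatoryIntegral_dsupport_eq_signCone`). The four pairs then differ only in ρ, D and
the scale of the form. In the unitary case the cone is also an intersection of moment map images,
because τ sends the coefficients cⱼ to ±cⱼ² with the sign fixed by j ≤ m. -/

namespace SupportProp

open FourierTransform LineDeriv Filter Topology

/-! ### Fourier multipliers (1 + ∂ᵥ)^{±1} and half spaces -/

section Symbol

variable {E : Type*} [NormedAddCommGroup E] [InnerProductSpace ℝ E]

/-- The Fourier symbol `1 + 2πi⟪ξ, v⟫` of the differential operator `1 + ∂ᵥ`. -/
noncomputable def symb (v ξ : E) : ℂ := 1 + 2 * Real.pi * Complex.I * (inner ℝ ξ v : ℝ)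

lemma symb_ne_zero (v ξ : E) : symb v ξ ≠ 0 := by
  intro h
  have := congrArg Complex.re h
  simp [symb] at this

lemma symb_hasTemperateGrowth (v : E) : Function.HasTemperateGrowth (symb v) := by
  unfold symb
  have h : Function.HasTemperateGrowth fun ξ : E => ((inner ℝ ξ v : ℝ) : ℂ) :=
    Function.Complex.hasTemperateGrowth_ofReal.comp (Function.hasTemperateGrowth_inner_left v)
  fun_prop

/-- Rationalize: 1/(1+iw) = (1-iw)(1+w²)⁻¹, and 1-iw is the symbol of -v. -/
lemma symb_inv_hasTemperateGrowth (v : E) :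
    Function.HasTemperateGrowth fun ξ : E => (symb v ξ)⁻¹ := by
  have hb : Function.HasTemperateGrowth fun ξ : E =>
      (((1 + ‖2 * Real.pi * (inner ℝ ξ v : ℝ)‖ ^ 2) ^ (-1 : ℝ) : ℝ) : ℂ) :=
    Function.Complex.hasTemperateGrowth_ofReal.comp
      ((Function.hasTemperateGrowth_one_add_norm_sq_rpow ℝ (-1)).comp
        (f := fun ξ : E => 2 * Real.pi * (inner ℝ ξ v : ℝ)) (by fun_prop))
  refine (congrArg Function.HasTemperateGrowth (funext fun ξ => ?_)).mpr
    ((symb_hasTemperateGrowth (-v)).mul hb)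
  have h0 := symb_ne_zero v ξ
  have h1 : (1 + ‖2 * Real.pi * (inner ℝ ξ v : ℝ)‖ ^ 2 : ℝ) ≠ 0 := by positivity
  have h2 : symb v ξ * symb (-v) ξ = ((1 + ‖2 * Real.pi * (inner ℝ ξ v : ℝ)‖ ^ 2 : ℝ) : ℂ) := by
    rw [Real.norm_eq_abs, sq_abs]
    simp only [symb, inner_neg_right]
    push_cast
    linear_combination (-4 * Real.pi ^ 2 * (inner ℝ ξ v : ℂ) ^ 2) * Complex.I_sq
  rw [Pi.mul_apply, Real.rpow_neg_one, Complex.ofReal_inv, ← h2]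
  have h3 := symb_ne_zero (-v) ξ
  field_simp

lemma symb_zpow_hasTemperateGrowth (v : E) (z : ℤ) :
    Function.HasTemperateGrowth fun ξ : E => symb v ξ ^ z := by
  obtain ⟨n, rfl | rfl⟩ := z.eq_nat_or_neg
  · simpa using! (symb_hasTemperateGrowth v).pow n
  · simpa [Pi.pow_def] using! (symb_inv_hasTemperateGrowth v).pow n

lemma hasTemperateGrowth_prod {ι : Type*} (s : Finset ι) (f : ι → E → ℂ)
    (h : ∀ i ∈ s, (f i).HasTemperateGrowth) :
    Function.HasTemperateGrowth fun x => ∏ i ∈ s, f i x := by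
  classical
  induction s using Finset.induction_on with
  | empty => simp [Function.HasTemperateGrowth.const]
  | insert i s hi ih =>
    simp only [Finset.prod_insert hi]
    exact (h i (by simp)).mul (ih fun j hj => h j (by simp [hj]))

variable [FiniteDimensional ℝ E] [MeasurableSpace E] [BorelSpace E]

lemma fourier_add_lineDeriv (v : E) (φ : 𝓢(E, ℂ)) (ξ : E) :
    𝓕 (φ + ∂_{v} φ) ξ = symb v ξ * 𝓕 φ ξ := by
  have : (inner ℝ · v).HasTemperateGrowth := Function.hasTemperateGrowth_inner_left v
  rw [FourierTransform.fourier_add, SchwartzMap.fourier_lineDerivOp_eq]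
  simp [this, symb, SchwartzMap.smulLeftCLM_apply_apply]
  ring

/-- Fourier inversion at the origin. It turns the pairing of a symbol with `𝓕 φ` into the value at 0
of the transformed function. -/
lemma integral_fourier_eq (ψ : 𝓢(E, ℂ)) : ∫ ξ, 𝓕 ψ ξ = ψ 0 := by
  have h : 𝓕⁻ (𝓕 ψ) 0 = ψ 0 := by rw [FourierTransform.fourierInv_fourier_eq]
  rw [← h, SchwartzMap.fourierInv_coe, Real.fourierInv_eq']
  simp

lemma exists_fourier_eq_mul {G : E → ℂ} (hG : G.HasTemperateGrowth) (φ : 𝓢(E, ℂ)) :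
    ∃ ψ : 𝓢(E, ℂ), ∀ ξ, 𝓕 ψ ξ = G ξ * 𝓕 φ ξ := by
  refine ⟨𝓕⁻ (SchwartzMap.smulLeftCLM ℂ G (𝓕 φ)), fun ξ => ?_⟩
  rw [FourierTransform.fourier_fourierInv_eq, SchwartzMap.smulLeftCLM_apply_apply hG, smul_eq_mul]

lemma schwartz_eq_of_fourier_eq {φ ψ : 𝓢(E, ℂ)} (h : ∀ ξ, 𝓕 φ ξ = 𝓕 ψ ξ) : φ = ψ := by
  have : 𝓕 φ = 𝓕 ψ := SchwartzMap.ext h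
  rw [← FourierTransform.fourierInv_fourier_eq (F := 𝓢(E, ℂ)) φ, this,
    FourierTransform.fourierInv_fourier_eq]

/-- The Fourier multiplier with symbol `G` preserves the class `Q` of Schwartz functions. -/
def MultiplierPreserves (Q : 𝓢(E, ℂ) → Prop) (G : E → ℂ) : Prop :=
  ∀ φ, Q φ → ∃ ψ, Q ψ ∧ ∀ ξ, 𝓕 ψ ξ = G ξ * 𝓕 φ ξ

namespace MultiplierPreserves

variable {Q : 𝓢(E, ℂ) → Prop}

lemma one : MultiplierPreserves Q fun _ => 1 := fun φ h => ⟨φ, h, by simp⟩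

lemma mul {G H : E → ℂ} (hG : MultiplierPreserves Q G) (hH : MultiplierPreserves Q H) :
    MultiplierPreserves Q fun ξ => G ξ * H ξ := fun φ h => by
  obtain ⟨ψ, hψ, e⟩ := hH φ h
  obtain ⟨χ, hχ, e'⟩ := hG ψ hψ
  exact ⟨χ, hχ, fun ξ => by rw [e', e, mul_assoc]⟩

lemma pow {G : E → ℂ} (hG : MultiplierPreserves Q G) (n : ℕ) :
    MultiplierPreserves Q fun ξ => G ξ ^ n := by
  induction n with
  | zero => simpa using one
  | succ n ih => simpa only [pow_succ] using ih.mul hG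

lemma prod {ι : Type*} (s : Finset ι) {G : ι → E → ℂ}
    (hG : ∀ i ∈ s, MultiplierPreserves Q (G i)) :
    MultiplierPreserves Q fun ξ => ∏ i ∈ s, G i ξ := by
  classical
  induction s using Finset.induction_on with
  | empty => simpa using one
  | insert i s hi ih =>
    simp only [Finset.prod_insert hi]
    exact (hG i (by simp)).mul (ih fun j hj => hG j (by simp [hj]))

lemma symb {v : E} (h : ∀ φ, Q φ → Q (φ + ∂_{v} φ)) : MultiplierPreserves Q (symb v) :=
  fun φ hφ => ⟨_, h φ hφ, fourier_add_lineDeriv v φ⟩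

lemma symb_zpow {v : E} {z : ℤ} (h : MultiplierPreserves Q (SupportProp.symb v))
    (h' : z < 0 → MultiplierPreserves Q fun ξ => (SupportProp.symb v ξ)⁻¹) :
    MultiplierPreserves Q fun ξ => SupportProp.symb v ξ ^ z := by
  rcases lt_or_ge z 0 with hz | hz
  · obtain ⟨n, rfl⟩ := Int.eq_negSucc_of_lt_zero hz
    simpa using (h' hz).pow (n + 1)
  · lift z to ℕ using hz
    simpa using h.pow z

end MultiplierPreserves

/-- The Schwartz functions vanishing on the half space `⟪y, e⟫ ≥ 0`. -/
def VanishesOnHalfSpace (e : E) (φ : 𝓢(E, ℂ)) : Prop := ∀ y : E, 0 ≤ inner ℝ y e → φ y = 0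

omit [FiniteDimensional ℝ E] [MeasurableSpace E] [BorelSpace E] in
lemma hasDerivAt_line (φ : 𝓢(E, ℂ)) (y v : E) (t : ℝ) :
    HasDerivAt (fun t : ℝ => φ (y + t • v)) (∂_{v} φ (y + t • v)) t := by
  rw [SchwartzMap.lineDerivOp_apply_eq_fderiv]
  have h1 : HasDerivAt (fun t : ℝ => y + t • v) v t := by
    simpa using ((hasDerivAt_id t).smul_const v).const_add y
  exact (φ.hasFDerivAt (y + t • v)).comp_hasDerivAt t h1

omit [FiniteDimensional ℝ E] [MeasurableSpace E] [BorelSpace E] in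
-- From any point of the closed half space, boundary included, one of the rays along v and -v stays
-- inside. A one-sided derivative along it is zero and determines the full one.
lemma VanishesOnHalfSpace.lineDeriv {e : E} {φ : 𝓢(E, ℂ)} (h : VanishesOnHalfSpace e φ) (v : E) :
    VanishesOnHalfSpace e (∂_{v} φ) := by
  intro y hy
  have hd : HasDerivAt (fun t : ℝ => φ (y + t • v)) (∂_{v} φ y) 0 := by
    simpa using hasDerivAt_line φ y v 0
  rcases le_total 0 (inner ℝ v e) with hv | hv
  · refine (uniqueDiffWithinAt_Ici (0 : ℝ)).eq_deriv _ hd.hasDerivWithinAt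
      ((hasDerivWithinAt_const (0 : ℝ) (Set.Ici 0) (0 : ℂ)).congr (fun t ht => ?_) ?_)
    · refine h _ ?_
      rw [inner_add_left, real_inner_smul_left]
      have : (0 : ℝ) ≤ t := ht
      positivity
    · simpa using h y hy
  · refine (uniqueDiffWithinAt_Iic (0 : ℝ)).eq_deriv _ hd.hasDerivWithinAt
      ((hasDerivWithinAt_const (0 : ℝ) (Set.Iic 0) (0 : ℂ)).congr (fun t ht => ?_) ?_)
    · refine h _ ?_
      rw [inner_add_left, real_inner_smul_left]
      have : t ≤ 0 := ht
      nlinarith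
    · simpa using h y hy

lemma multiplierPreserves_symb_halfSpace (e v : E) :
    MultiplierPreserves (VanishesOnHalfSpace e) (symb v) :=
  .symb fun φ h y hy => by simp [h y hy, h.lineDeriv v y hy]

lemma exists_inverse_add_lineDeriv (v : E) (φ : 𝓢(E, ℂ)) :
    ∃ ψ : 𝓢(E, ℂ), (∀ ξ, 𝓕 ψ ξ = (symb v ξ)⁻¹ * 𝓕 φ ξ) ∧ ψ + ∂_{v} ψ = φ := by
  obtain ⟨ψ, hψ⟩ := exists_fourier_eq_mul (symb_inv_hasTemperateGrowth v) φ
  refine ⟨ψ, hψ, schwartz_eq_of_fourier_eq fun ξ => ?_⟩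
  rw [fourier_add_lineDeriv, hψ, mul_inv_cancel_left₀ (symb_ne_zero v ξ)]

omit [FiniteDimensional ℝ E] [MeasurableSpace E] [BorelSpace E] in
-- The integrating factor eᵗ turns 1 + ∂ᵥ into a plain derivative along the line.
lemma hasDerivAt_exp_mul_line (ψ : 𝓢(E, ℂ)) (y v : E) (t : ℝ) :
    HasDerivAt (fun t : ℝ => (Real.exp t : ℂ) * ψ (y + t • v))
      ((Real.exp t : ℂ) * (ψ + ∂_{v} ψ) (y + t • v)) t := by
  refine ((Real.hasDerivAt_exp t).ofReal_comp.mul (hasDerivAt_line ψ y v t)).congr_deriv ?_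
  rw [add_apply, mul_add]

omit [FiniteDimensional ℝ E] [MeasurableSpace E] [BorelSpace E] in
lemma tendsto_exp_mul_line (ψ : 𝓢(E, ℂ)) (y v : E) :
    Tendsto (fun t : ℝ => (Real.exp t : ℂ) * ψ (y + t • v)) atBot (𝓝 0) := by
  have h : Tendsto (fun t : ℝ => Real.exp t * (SchwartzMap.seminorm ℝ 0 0) ψ) atBot (𝓝 0) := by
    simpa using Real.tendsto_exp_atBot.mul_const ((SchwartzMap.seminorm ℝ 0 0) ψ)
  refine squeeze_zero_norm (fun t => ?_) h
  rw [norm_mul, Complex.norm_real, Real.norm_eq_abs, abs_of_pos (Real.exp_pos t)]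
  gcongr
  exact SchwartzMap.norm_le_seminorm ℝ ψ _

/-- The resolvent at y only sees the backward ray y + tv, t ≤ 0, which stays in the half space when
⟪v, e⟫ ≤ 0. There eᵗψ(y + tv) is constant, and it tends to 0 at -∞. -/
lemma multiplierPreserves_symb_inv_halfSpace {e v : E} (hv : inner ℝ v e ≤ 0) :
    MultiplierPreserves (VanishesOnHalfSpace e) fun ξ => (symb v ξ)⁻¹ := by
  intro φ hφ
  obtain ⟨ψ, hψ, hψφ⟩ := exists_inverse_add_lineDeriv v φ
  refine ⟨ψ, fun y hy => ?_, hψ⟩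
  have hd := hasDerivAt_exp_mul_line ψ y v
  have hconst : ∀ t ≤ (0 : ℝ), (Real.exp t : ℂ) * ψ (y + t • v) = ψ y := by
    intro t ht
    have := constant_of_has_deriv_right_zero (a := t) (b := 0)
      (f := fun t : ℝ => (Real.exp t : ℂ) * ψ (y + t • v))
      (fun s _ => (hd s).continuousAt.continuousWithinAt) (fun s hs => by
        have h0 : (Real.exp s : ℂ) * (ψ + ∂_{v} ψ) (y + s • v) = 0 := by
          rw [hψφ, hφ, mul_zero]
          rw [inner_add_left, real_inner_smul_left]
          have := hs.2
          nlinarith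
        rw [← h0]
        exact (hd s).hasDerivWithinAt) 0 (by simp [ht])
    simpa using this.symm
  have h1 : Tendsto (fun t : ℝ => (Real.exp t : ℂ) * ψ (y + t • v)) atBot (𝓝 (ψ y)) :=
    tendsto_const_nhds.congr' (by
      filter_upwards [eventually_le_atBot 0] with t ht using (hconst t ht).symm)
  exact tendsto_nhds_unique h1 (tendsto_exp_mul_line ψ y v)

end Symbol

end SupportProp

namespace SupportProp

open FourierTransform LineDeriv Filter Topology

/-! ### Test functions on the line -/

section OneDimensional

lemma exists_schwartz_bump {c : ℝ} (f : ContDiffBump c) :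
    ∃ φ : 𝓢(ℝ, ℂ), (∀ y, φ y = (f y : ℂ)) ∧ tsupport φ = Metric.closedBall c f.rOut := by
  have hc : HasCompactSupport fun y => (f y : ℂ) :=
    f.hasCompactSupport.comp_left (g := ((↑) : ℝ → ℂ)) Complex.ofReal_zero
  refine ⟨hc.toSchwartzMap (Complex.ofRealCLM.contDiff.comp f.contDiff), fun y => rfl, ?_⟩
  rw [← f.tsupport_eq]
  refine congrArg closure ?_
  ext y
  exact not_congr Complex.ofReal_eq_zero

/-- A function equal to 1 near 0 stays so under 1 ± v∂, since its derivative vanishes there. -/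
lemma exists_test_polynomial (v : ℝ) (a b : ℕ) {ε : ℝ} (hε : 0 < ε) :
    ∃ φ : 𝓢(ℝ, ℂ), tsupport φ ⊆ Metric.ball 0 ε ∧
      ∫ ξ, symb v ξ ^ a * symb (-v) ξ ^ b * 𝓕 φ ξ ≠ 0 := by
  let f : ContDiffBump (0 : ℝ) := ⟨ε / 4, ε / 2, by positivity, by linarith⟩
  obtain ⟨φ, hφ, hs⟩ := exists_schwartz_bump f
  refine ⟨φ, hs.trans_subset (Metric.closedBall_subset_ball (half_lt_self hε)), ?_⟩
  let Q : 𝓢(ℝ, ℂ) → Prop := fun φ => ∀ᶠ y in 𝓝 0, φ y = 1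
  have hQ : Q φ := by
    filter_upwards [f.eventuallyEq_one] with y hy
    rw [hφ, hy]
    simp
  have key (v : ℝ) : MultiplierPreserves Q (symb v) := by
    refine .symb fun χ hχ => ?_
    filter_upwards [hχ.eventually_nhds] with y hy
    have h1 : fderiv ℝ χ y = 0 := by
      rw [Filter.EventuallyEq.fderiv_eq (f := fun _ => (1 : ℂ)) hy]
      simp
    simp [SchwartzMap.lineDerivOp_apply_eq_fderiv, h1, hy.self_of_nhds]
  obtain ⟨ψ, hψ, e⟩ := ((key v).pow a).mul ((key (-v)).pow b) φ hQ
  simp only [← e]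
  rw [integral_fourier_eq, hψ.self_of_nhds]
  exact one_ne_zero

/-- ψ(0) is the integral of eᵗ f(-tv) over t ≤ 0. The integrand is nonnegative, and the ray passes
through the centre c of the bump because c and v have the same sign. -/
lemma resolvent_apply_zero_ne_zero {v c : ℝ} (f : ContDiffBump c) (hcv : 0 < c * v)
    {φ ψ : 𝓢(ℝ, ℂ)} (hφ : ∀ y, φ y = (f y : ℂ)) (hψ : ψ + ∂_{-v} ψ = φ) : ψ 0 ≠ 0 := by
  intro h0
  have hv : v ≠ 0 := by rintro rfl; simp at hcv
  let g : ℝ → ℝ := fun t => ((Real.exp t : ℂ) * ψ (0 + t • -v)).re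
  have hd (t : ℝ) : HasDerivAt g (Real.exp t * f (0 + t • -v)) t := by
    have := hasDerivAt_exp_mul_line ψ 0 (-v) t
    rw [hψ, hφ, ← Complex.ofReal_mul] at this
    exact Complex.reCLM.hasFDerivAt.comp_hasDerivAt t this
  have hmono : Monotone g := monotone_of_hasDerivAt_nonneg hd fun t =>
    mul_nonneg (Real.exp_pos t).le f.nonneg
  have hlim : Tendsto g atBot (𝓝 0) := by
    exact (Complex.continuous_re.tendsto 0).comp (tendsto_exp_mul_line ψ 0 (-v))
  have hzero : ∀ t ≤ 0, g t = 0 := fun t ht =>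
    le_antisymm ((hmono ht).trans (by simp [g, h0])) (hmono.le_of_tendsto hlim t)
  -- The time at which the ray meets c; the derivative of g there is positive, against g being zero
  -- for t ≤ 0.
  have ht : -(c / v) < 0 := by
    have : c / v = c * v / (v * v) := by field_simp
    rw [this]
    have : 0 < v * v := mul_self_pos.mpr hv
    have := div_pos hcv this
    linarith
  have hc : HasDerivAt g 0 (-(c / v)) :=
    (hasDerivAt_const _ (0 : ℝ)).congr_of_eventuallyEq (by
      filter_upwards [Iio_mem_nhds ht] with t ht using hzero t (le_of_lt ht))
  have h1 := (hd (-(c / v))).unique hc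
  have h2 : (0 : ℝ) + -(c / v) • -v = c := by
    simp [hv]
  rw [h2, f.one_of_mem_closedBall (by simpa using f.rIn_pos.le)] at h1
  simp at h1

/-- Modulo 1 - v∂, the operator 1 + v∂ = 2 - (1 - v∂) is multiplication by 2. The error terms are
differential operators applied to φ, which vanish at 0. -/
lemma exists_fourier_symb_pow_mul {v : ℝ} {φ ψ : 𝓢(ℝ, ℂ)} (hφ : VanishesOnHalfSpace (-v) φ)
    (hψ : ∀ ξ, 𝓕 ψ ξ = (symb (-v) ξ)⁻¹ * 𝓕 φ ξ) (a : ℕ) :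
    ∃ χ : 𝓢(ℝ, ℂ), (∀ ξ, 𝓕 χ ξ = symb v ξ ^ a * ((symb (-v) ξ)⁻¹ * 𝓕 φ ξ)) ∧
      χ 0 = 2 ^ a * ψ 0 := by
  induction a with
  | zero => exact ⟨ψ, by simpa using hψ, by simp⟩
  | succ a ih =>
    obtain ⟨χ, hχ, h0⟩ := ih
    obtain ⟨θ, hθ, e⟩ := ((multiplierPreserves_symb_halfSpace (-v) v).pow a) φ hφ
    -- Here θ = (1+v∂)ᵃφ = (1-v∂)χ, so 2χ - θ = (1+v∂)χ.
    refine ⟨χ + χ - θ, fun ξ => ?_, ?_⟩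
    · rw [sub_eq_add_neg, FourierTransform.fourier_add, FourierTransform.fourier_add,
        FourierTransform.fourier_neg, add_apply, add_apply, neg_apply,
        hχ, e]
      have h1 := symb_ne_zero (-v) ξ
      have h2 : symb v ξ = 2 - symb (-v) ξ := by
        simp only [symb, inner_neg_right]
        push_cast
        ring
      rw [pow_succ]
      nth_rw 4 [h2]
      field_simp
      ring
    · rw [sub_apply, add_apply, h0, hθ 0 (by simp)]
      ring

/-- Applying (1-v∂)^N to a bump cancels all but one power of the pole without enlarging the support.
The remaining single resolvent is positive on the bump. -/
lemma exists_test_pole {v y₀ : ℝ} (hv : v ≠ 0) (hy : 0 ≤ y₀ * v) (a N : ℕ) {ε : ℝ} (hε : 0 < ε) :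
    ∃ φ : 𝓢(ℝ, ℂ), tsupport φ ⊆ Metric.ball y₀ ε ∧
      ∫ ξ, symb v ξ ^ a * (symb (-v) ξ ^ (N + 1))⁻¹ * 𝓕 φ ξ ≠ 0 := by
  have hv' : 0 < |v| := abs_pos.mpr hv
  have hsv : SignType.sign v * v = |v| := sign_mul_self v
  have hs1 : |(SignType.sign v : ℝ)| = 1 := by
    rcases hv.lt_or_gt with h | h <;> simp [h]
  -- The centre is pushed from y₀ in the direction of v, so that the bump lies strictly inside y·v >
  -- 0 even when y₀ = 0.
  obtain ⟨c, hc⟩ : ∃ c, c = y₀ + SignType.sign v * (ε / 2) := ⟨_, rfl⟩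
  have hcv : c * v = y₀ * v + |v| * (ε / 2) := by rw [hc, ← hsv]; ring
  let f : ContDiffBump c := ⟨ε / 8, ε / 4, by positivity, by linarith⟩
  obtain ⟨φ₀, hφ₀, hs⟩ := exists_schwartz_bump f
  have hsub : tsupport φ₀ ⊆ Metric.ball y₀ ε := by
    rw [hs]
    refine Metric.closedBall_subset_ball' ?_
    have : dist c y₀ = ε / 2 := by
      rw [hc, Real.dist_eq, add_sub_cancel_left, abs_mul, hs1, one_mul, abs_of_pos (half_pos hε)]
    rw [this]
    change ε / 4 + ε / 2 < ε
    linarith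
  have hhalf : VanishesOnHalfSpace (-v) φ₀ := by
    intro y hy'
    rw [hφ₀, f.zero_of_le_dist, Complex.ofReal_zero]
    change ε / 4 ≤ dist y c
    have h1 : y * v ≤ 0 := by
      have : inner ℝ y (-v) = -(y * v) := by simp [mul_comm]
      linarith
    have h2 : |v| * (ε / 2) ≤ |y - c| * |v| := by
      rw [← abs_mul]
      refine le_trans ?_ (neg_le_abs _)
      linarith
    rw [Real.dist_eq]
    have h3 : ε / 2 ≤ |y - c| := le_of_mul_le_mul_left (by linarith) hv'
    linarith
  have hQ : MultiplierPreserves (fun φ : 𝓢(ℝ, ℂ) => tsupport φ ⊆ Metric.ball y₀ ε)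
      (symb (-v)) := by
    refine .symb fun φ hφ => (tsupport_add _ _).trans ?_
    exact Set.union_subset hφ ((SchwartzMap.tsupport_lineDerivOp_subset _ _).trans hφ)
  obtain ⟨φ, hφ, e⟩ := hQ.pow N φ₀ hsub
  obtain ⟨ψ, hψ, hψφ⟩ := exists_inverse_add_lineDeriv (-v) φ₀
  obtain ⟨χ, hχ, hχ0⟩ := exists_fourier_symb_pow_mul hhalf hψ a
  refine ⟨φ, hφ, ?_⟩
  have : ∀ ξ, symb v ξ ^ a * (symb (-v) ξ ^ (N + 1))⁻¹ * 𝓕 φ ξ = 𝓕 χ ξ := by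
    intro ξ
    have := symb_ne_zero (-v) ξ
    rw [e, hχ]
    field_simp
    ring
  simp only [this]
  rw [integral_fourier_eq, hχ0]
  refine mul_ne_zero (by simp) (resolvent_apply_zero_ne_zero f ?_ hφ₀ hψφ)
  rw [hcv]
  positivity

/-- Points of the line at which a distribution with Fourier symbol `(1 + vD)ᵃ (1 - vD)ᵇ` is
supported. -/
def rayCondition (v : ℝ) (a b : ℤ) (y : ℝ) : Prop :=
  (0 ≤ a → 0 ≤ y * v) ∧ (0 ≤ b → y * v ≤ 0)

lemma exists_test_line {v y₀ : ℝ} (hv : v ≠ 0) {a b : ℤ} (hab : 0 ≤ a ∨ 0 ≤ b)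
    (hy : rayCondition v a b y₀) {ε : ℝ} (hε : 0 < ε) :
    ∃ φ : 𝓢(ℝ, ℂ), tsupport φ ⊆ Metric.ball y₀ ε ∧
      ∫ ξ, symb v ξ ^ a * symb (-v) ξ ^ b * 𝓕 φ ξ ≠ 0 := by
  rcases lt_or_ge b 0 with hb | hb
  · have ha : 0 ≤ a := hab.resolve_right (not_le.mpr hb)
    obtain ⟨N, rfl⟩ := Int.eq_negSucc_of_lt_zero hb
    lift a to ℕ using ha
    simpa using exists_test_pole hv (hy.1 (by simp)) a N hε
  rcases lt_or_ge a 0 with ha | ha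
  · obtain ⟨N, rfl⟩ := Int.eq_negSucc_of_lt_zero ha
    lift b to ℕ using hb
    -- A pole in 1 + v∂ is the mirror image: replacing v by -v exchanges the two factors.
    have := exists_test_pole (v := -v) (y₀ := y₀) (neg_ne_zero.mpr hv)
      (by have := hy.2 (by simp); linarith) b N hε
    simpa [mul_comm] using this
  · have h0 : y₀ = 0 := by
      have := le_antisymm (hy.2 hb) (hy.1 ha)
      exact (mul_eq_zero.mp this).resolve_right hv
    subst h0
    lift a to ℕ using ha
    lift b to ℕ using hb
    simpa using exists_test_polynomial v a b hε

end OneDimensional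

end SupportProp

namespace SupportProp

open FourierTransform LineDeriv Filter Topology

/-! ### Products over the coordinates and the support in ℝⁿ -/

section Coordinates

variable {n : ℕ}

lemma symb_single (k : Fin n) (v : ℝ) (ξ : Coord n) :
    symb (EuclideanSpace.single k v) ξ = symb v (ξ k) := by
  simp [symb, EuclideanSpace.inner_single_right, mul_comm]

lemma integral_coord_prod (f : Fin n → ℝ → ℂ) :
    ∫ x : Coord n, ∏ k, f k (x k) = ∏ k, ∫ t, f k t := by
  rw [← integral_fintype_prod_volume_eq_prod,
    ← (PiLp.volume_preserving_toLp (Fin n)).integral_comp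
      (MeasurableEquiv.toLp 2 (Fin n → ℝ)).measurableEmbedding]

lemma exists_schwartz_prod (φ : Fin n → 𝓢(ℝ, ℂ)) (hc : ∀ k, IsCompact (tsupport (φ k))) :
    ∃ Φ : 𝓢(Coord n, ℂ), tsupport Φ ⊆ {y | ∀ k, y k ∈ tsupport (φ k)} ∧
      ∀ ξ, 𝓕 Φ ξ = ∏ k, 𝓕 (φ k) (ξ k) := by
  have hK : IsCompact {y : Coord n | ∀ k, y k ∈ tsupport (φ k)} := by
    have := (EuclideanSpace.equiv (Fin n) ℝ).toHomeomorph.isCompact_preimage.mpr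
      (isCompact_univ_pi hc)
    convert this using 1
    ext y
    simp
  have hsub : (Function.support fun y : Coord n => ∏ k, φ k (y k)) ⊆
      {y | ∀ k, y k ∈ tsupport (φ k)} := fun y hy k =>
    subset_tsupport _ fun h => hy (Finset.prod_eq_zero (Finset.mem_univ k) h)
  have hs : ContDiff ℝ (⊤ : ℕ∞) fun y : Coord n => ∏ k, φ k (y k) :=
    contDiff_prod fun k _ => ((φ k).smooth ⊤).comp (EuclideanSpace.proj (𝕜 := ℝ) k).contDiff
  refine ⟨(HasCompactSupport.of_support_subset_isCompact hK hsub).toSchwartzMap hs,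
    closure_minimal hsub hK.isClosed, fun ξ => ?_⟩
  simp only [SchwartzMap.fourier_coe, Real.fourier_eq', smul_eq_mul]
  rw [← integral_coord_prod]
  refine integral_congr_ae (.of_forall fun y => ?_)
  simp only [HasCompactSupport.toSchwartzMap_toFun, Finset.prod_mul_distrib, ← Complex.exp_sum]
  congr 2
  rw [PiLp.inner_apply, Finset.mul_sum]
  push_cast
  rw [Finset.sum_mul]

/-- The product of the symbols of `(1 + vDₖ)^{aₖ} (1 - vDₖ)^{bₖ}`. -/
noncomputable def coordSymbol (v : ℝ) (a b : Fin n → ℤ) (ξ : Coord n) : ℂ :=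
  ∏ k, symb v (ξ k) ^ a k * symb (-v) (ξ k) ^ b k

lemma coordSymbol_hasTemperateGrowth (v : ℝ) (a b : Fin n → ℤ) :
    Function.HasTemperateGrowth (coordSymbol v a b) := by
  refine hasTemperateGrowth_prod _ _ fun k _ => ?_
  simp only [← symb_single]
  exact (symb_zpow_hasTemperateGrowth _ _).mul (symb_zpow_hasTemperateGrowth _ _)

/-- The sign conditions say that every ray used by an inverse factor stays in the half space. The
transformed function thus vanishes on it, in particular at 0. -/
lemma integral_coordSymbol_eq_zero {v : ℝ} {a b : Fin n → ℤ} {e : Coord n}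
    (ha : ∀ k, a k < 0 → v * e k ≤ 0) (hb : ∀ k, b k < 0 → 0 ≤ v * e k)
    {φ : 𝓢(Coord n, ℂ)} (hφ : VanishesOnHalfSpace e φ) :
    ∫ ξ, coordSymbol v a b ξ * 𝓕 φ ξ = 0 := by
  have key : MultiplierPreserves (VanishesOnHalfSpace e) (coordSymbol v a b) := by
    refine .prod _ fun k _ => ?_
    simp only [← symb_single]
    refine (MultiplierPreserves.symb_zpow (multiplierPreserves_symb_halfSpace _ _) fun h =>
      multiplierPreserves_symb_inv_halfSpace ?_).mul
      (MultiplierPreserves.symb_zpow (multiplierPreserves_symb_halfSpace _ _) fun h =>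
      multiplierPreserves_symb_inv_halfSpace ?_)
    · simpa [EuclideanSpace.inner_single_left] using ha k h
    · simpa [EuclideanSpace.inner_single_left] using hb k h
  obtain ⟨ψ, hψ, h⟩ := key φ hφ
  simp only [← h]
  rw [integral_fourier_eq, hψ 0 (by simp)]

lemma exists_test_coord {v : ℝ} (hv : v ≠ 0) {a b : Fin n → ℤ} (hab : ∀ k, 0 ≤ a k ∨ 0 ≤ b k)
    {y₀ : Coord n} (hy : ∀ k, rayCondition v (a k) (b k) (y₀ k)) {s : Set (Coord n)}
    (hs : IsOpen s) (hys : y₀ ∈ s) :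
    ∃ Φ : 𝓢(Coord n, ℂ), tsupport Φ ⊆ s ∧ ∫ ξ, coordSymbol v a b ξ * 𝓕 Φ ξ ≠ 0 := by
  have hcont : Continuous (WithLp.toLp 2 : (Fin n → ℝ) → Coord n) := PiLp.continuous_toLp 2 _
  -- The sup metric makes balls into products of intervals, which suits product test functions.
  obtain ⟨ε, hε, hball⟩ := Metric.isOpen_iff.mp (hs.preimage hcont) (WithLp.ofLp y₀) (by simpa)
  choose φ hφ hne using fun k => exists_test_line hv (hab k) (hy k) hε
  obtain ⟨Φ, hΦ, e⟩ := exists_schwartz_prod φ fun k =>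
    Metric.isCompact_of_isClosed_isBounded (isClosed_tsupport _)
      (Metric.isBounded_ball.subset (hφ k))
  refine ⟨Φ, fun y h => ?_, ?_⟩
  · have : WithLp.ofLp y ∈ Metric.ball (WithLp.ofLp y₀) ε := by
      rw [Metric.mem_ball, dist_pi_lt_iff hε]
      exact fun k => hφ k (hΦ h k)
    simpa using hball this
  · simp only [coordSymbol, e, ← Finset.prod_mul_distrib]
    rw [integral_coord_prod fun k t => symb v t ^ a k * symb (-v) t ^ b k * 𝓕 (φ k) t]
    exact Finset.prod_ne_zero_iff.mpr fun k _ => hne k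

theorem exists_isOscillatoryIntegral_dsupport {c : ℝ} (hc : 0 < c) {a b : Fin n → ℤ}
    (hab : ∀ k, 0 ≤ a k ∨ 0 ≤ b k) {F : Coord n → ℂ} {B : Coord n → Coord n → ℝ}
    (hF : ∀ x, F x = ∏ k, (1 + Complex.I * x k) ^ a k * (1 - Complex.I * x k) ^ b k)
    (hB : ∀ x y, B x y = -(c * ∑ k, x k * y k)) :
    ∃ T : 𝓢'(Coord n, ℂ), IsOscillatoryIntegral F B T ∧
      Distribution.dsupport T = {y | ∀ k, (0 ≤ a k → 0 ≤ y k) ∧ (0 ≤ b k → y k ≤ 0)} := by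
  have hG := coordSymbol_hasTemperateGrowth c⁻¹ a b
  -- With r = c/2π the phase B(x,y) becomes -2π⟪y, r x⟫, and the symbol of v = c⁻¹ at r xₖ is 1 +
  -- ixₖ.
  obtain ⟨r, hr⟩ : ∃ r, r = c / (2 * Real.pi) := ⟨_, rfl⟩
  have hr0 : 0 < r := hr ▸ by positivity
  have hFG : ∀ x, F x = coordSymbol c⁻¹ a b (r • x) := by
    intro x
    have h1 (k : Fin n) : symb c⁻¹ ((r • x) k) = 1 + Complex.I * x k := by
      simp only [symb, PiLp.smul_apply, smul_eq_mul, RCLike.inner_apply, conj_trivial, hr]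
      have := Complex.ofReal_ne_zero.mpr hc.ne'
      have := Complex.ofReal_ne_zero.mpr Real.pi_ne_zero
      push_cast
      field_simp
    have h2 (k : Fin n) : symb (-c⁻¹) ((r • x) k) = 1 - Complex.I * x k := by
      have h := h1 k
      simp only [symb, inner_neg_right] at h ⊢
      push_cast at h ⊢
      linear_combination -h
    simp only [hF, coordSymbol, h1, h2]
  have hB' (φ : 𝓢(Coord n, ℂ)) (x : Coord n) :
      ∫ y, Complex.exp (Complex.I * (B x y : ℂ)) * φ y = 𝓕 φ (r • x) := by
    rw [SchwartzMap.fourier_coe, Real.fourier_eq']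
    refine integral_congr_ae (.of_forall fun y => ?_)
    simp only [smul_eq_mul]
    congr 2
    rw [mul_comm]
    congr 2
    rw [hB, inner_smul_right, PiLp.inner_apply, hr]
    simp only [RCLike.inner_apply, conj_trivial]
    field_simp
  have hint (φ : 𝓢(Coord n, ℂ)) : Integrable fun ξ => coordSymbol c⁻¹ a b ξ * 𝓕 φ ξ := by
    obtain ⟨ψ, hψ⟩ := exists_fourier_eq_mul hG φ
    simpa only [← hψ] using (𝓕 ψ).integrable
  -- The Jacobian of the substitution ξ = r x.
  let C : ℝ := |(r ^ Module.finrank ℝ (Coord n))⁻¹|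
  have hC : C ≠ 0 := by positivity
  let T : 𝓢'(Coord n, ℂ) := (C : ℂ) • 𝓕 (hG.toTemperedDistribution volume)
  have hT (φ : 𝓢(Coord n, ℂ)) : T φ = C * ∫ ξ, coordSymbol c⁻¹ a b ξ * 𝓕 φ ξ := by
    change C * ∫ ξ, 𝓕 φ ξ * coordSymbol c⁻¹ a b ξ = _
    simp only [mul_comm (𝓕 φ _)]
  refine ⟨T, fun φ => ?_, ?_⟩
  · simp only [hB', hFG, hT]
    refine ⟨(hint φ).comp_smul hr0.ne', ?_⟩
    rw [Measure.integral_comp_smul volume fun ξ => coordSymbol c⁻¹ a b ξ * 𝓕 φ ξ]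
    simp [C]
  ext y
  constructor
  · intro hy
    by_contra hy'
    -- A point in the open half space ⟪z, e⟫ < 0 is off the support whenever e is compatible with
    -- all inverse factors. Below e is ± a basis vector: only coordinate k matters, and there the
    -- exponent that would obstruct is nonnegative.
    have vanish (e : Coord n) (ha : ∀ k, a k < 0 → c⁻¹ * e k ≤ 0)
        (hb : ∀ k, b k < 0 → 0 ≤ c⁻¹ * e k) (hye : inner ℝ y e < 0) : False := by
      refine (Distribution.notMem_dsupport_iff y).mpr ⟨{z | inner ℝ z e < 0}, fun φ hφ => ?_,
        isOpen_lt (by fun_prop) continuous_const, hye⟩ hy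
      rw [hT, integral_coordSymbol_eq_zero ha hb, mul_zero]
      intro z hz
      by_contra h
      exact not_lt.mpr hz (hφ (subset_tsupport _ h))
    have hc' := inv_pos.mpr hc
    simp only [Set.mem_ofPred_eq, not_forall, not_and_or, not_le] at hy'
    obtain ⟨k, ⟨hk, hyk⟩ | ⟨hk, hyk⟩⟩ := hy'
    · refine vanish (EuclideanSpace.single k 1) (fun j hj => ?_) (fun j hj => ?_) ?_
      · have : j ≠ k := by rintro rfl; omega
        simp [this]
      · by_cases h : j = k <;> simp [h, hc'.le]
      · simpa [EuclideanSpace.inner_single_right] using hyk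
    · refine vanish (EuclideanSpace.single k (-1)) (fun j hj => ?_) (fun j hj => ?_) ?_
      · by_cases h : j = k <;> simp [h, hc'.le]
      · have : j ≠ k := by rintro rfl; omega
        simp [this]
      · simpa [EuclideanSpace.inner_single_right] using hyk
  · intro hy
    rw [Distribution.mem_dsupport_iff_forall_exists_ne]
    intro s hys hs
    obtain ⟨Φ, hΦ, hne⟩ := exists_test_coord (inv_ne_zero hc.ne') hab (fun k =>
      ⟨fun h => mul_nonneg ((hy k).1 h) (inv_pos.mpr hc).le,
        fun h => mul_nonpos_of_nonpos_of_nonneg ((hy k).2 h) (inv_pos.mpr hc).le⟩) hs hys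
    exact ⟨Φ, hΦ, by rw [hT]; exact mul_ne_zero (by exact_mod_cast hC) hne⟩

end Coordinates

end SupportProp

namespace SupportProp

/-! ### Factoring the kernel; the sign cone from the exponents -/

section Kernels

lemma one_add_I_mul (x : ℝ) :
    1 + Complex.I * x = (Real.sqrt (1 + x ^ 2) : ℂ) * Complex.exp (Real.arctan x * Complex.I) := by
  have h : Real.sqrt (1 + x ^ 2) ≠ 0 := by positivity
  rw [Complex.exp_mul_I, ← Complex.ofReal_cos, ← Complex.ofReal_sin, Real.cos_arctan,
    Real.sin_arctan]
  have := Complex.ofReal_ne_zero.mpr h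
  push_cast
  field_simp

lemma one_sub_I_mul (x : ℝ) :
    1 - Complex.I * x =
      (Real.sqrt (1 + x ^ 2) : ℂ) * Complex.exp (-(Real.arctan x * Complex.I)) := by
  have h := one_add_I_mul (-x)
  rw [Real.arctan_neg, neg_sq, Complex.ofReal_neg, Complex.ofReal_neg, neg_mul] at h
  rw [← h]
  ring

lemma cMinus_I_mul (x : ℝ) :
    cMinus (Complex.I * x) = Complex.exp ((2 * Real.arctan x : ℝ) * Complex.I) := by
  have h : (Real.sqrt (1 + x ^ 2) : ℂ) ≠ 0 := by
    exact_mod_cast (by positivity : Real.sqrt (1 + x ^ 2) ≠ 0)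
  have h1 : cMinus (Complex.I * x) = (1 + Complex.I * x) / (1 - Complex.I * x) := by
    rw [cMinus, ← neg_sub 1 (Complex.I * x), div_neg]
    norm_num
    ring
  rw [h1, one_add_I_mul, one_sub_I_mul, mul_div_mul_left _ _ h, ← Complex.exp_sub]
  congr 1
  push_cast
  ring

/-- In polar form 1 ± ix = √(1+x²) e^{±i arctan x}, and c₋(ix) = e^{2i arctan x}. Since |2 arctan x|
< π, the principal logarithm is 2i arctan x, so moduli and arguments can be compared separately. -/
lemma cMinus_cpow_mul {x μ : ℝ} {D a : ℤ} (ha : (a : ℝ) = D / 2 - μ) :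
    cMinus (Complex.I * x) ^ ((-μ : ℝ) : ℂ) * ((Real.sqrt (1 + x ^ 2) ^ D : ℝ) : ℂ) =
      (1 + Complex.I * x) ^ a * (1 - Complex.I * x) ^ (D - a) := by
  have h : (Real.sqrt (1 + x ^ 2) : ℂ) ≠ 0 := by
    exact_mod_cast (by positivity : Real.sqrt (1 + x ^ 2) ≠ 0)
  have hlog : Complex.log (cMinus (Complex.I * x)) = (2 * Real.arctan x : ℝ) * Complex.I := by
    rw [cMinus_I_mul, Complex.log_exp]
    · have := Real.neg_pi_div_two_lt_arctan x
      rw [Complex.im_ofReal_mul, Complex.I_im]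
      linarith
    · have := Real.arctan_lt_pi_div_two x
      rw [Complex.im_ofReal_mul, Complex.I_im]
      linarith
  rw [Complex.cpow_def_of_ne_zero (by rw [cMinus_I_mul]; exact Complex.exp_ne_zero _), hlog,
    one_add_I_mul, one_sub_I_mul, mul_zpow, mul_zpow, ← Complex.exp_int_mul, ← Complex.exp_int_mul,
    mul_mul_mul_comm, ← zpow_add₀ h, ← Complex.exp_add, mul_comm]
  have hμ : (μ : ℂ) = D / 2 - a := by
    have : μ = D / 2 - a := by linarith
    rw [this]
    push_cast
    rfl
  congr 1
  · push_cast
    congr 1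
    ring
  · congr 1
    push_cast
    rw [hμ]
    ring

variable {n : ℕ}

/-- By monotonicity the indices with μₖ ≤ -t form an initial segment. The set counts from 1 and
`Fin` from 0, so its maximum is the length of that segment. -/
lemma mem_lowIdx_iff [NeZero n] {μ : Fin n → ℝ} (hμ : Monotone μ) (t : ℝ) (k : Fin n) :
    (k : ℕ) < lowIdx t μ ↔ μ k ≤ -t := by
  let S : Set ℕ := {j : ℕ | ∃ i : Fin n, j = (i : ℕ) + 1 ∧ μ i ≤ -t}
  have hbdd : BddAbove S := ⟨n, by rintro j ⟨i, rfl, -⟩; omega⟩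
  rw [lowIdx]
  split_ifs with h
  · refine ⟨fun hk => ?_, fun hk => ?_⟩
    · obtain ⟨i, hi, hi'⟩ := Nat.sSup_mem (s := S) ⟨_, 0, rfl, h⟩ hbdd
      refine (hμ (Fin.le_def.mpr ?_)).trans hi'
      change (k : ℕ) < sSup S at hk
      omega
    · exact le_csSup hbdd ⟨k, rfl, hk⟩
  · simp only [not_lt_zero, false_iff]
    exact fun hk => h ((hμ (Fin.zero_le k)).trans hk)

lemma highIdx_le_iff [NeZero n] {μ : Fin n → ℝ} (hμ : Monotone μ) (t : ℝ) (k : Fin n) :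
    highIdx t μ ≤ (k : ℕ) ↔ t ≤ μ k := by
  let S : Set ℕ := {j : ℕ | ∃ i : Fin n, j = (i : ℕ) + 1 ∧ t ≤ μ i}
  have hle : k ≤ Fin.rev 0 := by
    rw [Fin.le_def, Fin.val_rev]
    simp
    omega
  rw [highIdx]
  split_ifs with h
  · obtain ⟨i, hi, hi'⟩ := Nat.sInf_mem (s := S) ⟨_, _, rfl, h⟩
    refine ⟨fun hk => ?_, fun hk => ?_⟩
    · refine hi'.trans (hμ (Fin.le_def.mpr ?_))
      change sInf S - 1 ≤ k at hk
      omega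
    · have : sInf S ≤ k + 1 := Nat.sInf_le ⟨k, rfl, hk⟩
      change sInf S - 1 ≤ k
      omega
  · have := k.2
    simp only [not_le.mpr this, false_iff]
    exact fun hk => h (hk.trans (hμ hle))

lemma lowIdx_le [NeZero n] (μ : Fin n → ℝ) (t : ℝ) : lowIdx t μ ≤ n := by
  rw [lowIdx]
  split_ifs with h
  · exact csSup_le' (by rintro j ⟨i, rfl, -⟩; exact i.2)
  · exact Nat.zero_le n

lemma highIdx_le [NeZero n] (μ : Fin n → ℝ) (t : ℝ) : highIdx t μ ≤ n := by
  rw [highIdx]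
  split_ifs with h
  · have : sInf {j : ℕ | ∃ i : Fin n, j = (i : ℕ) + 1 ∧ t ≤ μ i} ≤ ((Fin.rev 0 : Fin n) : ℕ) + 1 :=
      Nat.sInf_le ⟨_, rfl, h⟩
    exact (Nat.sub_le _ _).trans (this.trans (Fin.rev 0).2)
  · exact le_rfl

/-- The support of the oscillatory integral of `c₋(x)^{-μ} ∏ₖ (1 + xₖ²)^{D/2}`. -/
theorem exists_isOscillatoryIntegral_dsupport_eq_signCone [NeZero n] {c : ℝ} (hc : 0 < c) {D : ℤ}
    {μ : Fin n → ℝ} (hμ : Monotone μ) (hint : ∀ k, ∃ a : ℤ, (a : ℝ) = D / 2 - μ k) {t : ℝ}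
    (ht : t = D / 2 + 1) (hdisj : ∀ k, t ≤ μ k → -t < μ k)
    {F : Coord n → ℂ} {B : Coord n → Coord n → ℝ}
    (hF : ∀ x, F x = cMinusPow (fun k => Complex.I * (x k : ℂ)) (-μ) *
      ((∏ k, Real.sqrt (1 + x k ^ 2) ^ D : ℝ) : ℂ))
    (hB : ∀ x y, B x y = -(c * ∑ k, x k * y k)) :
    ∃ T : 𝓢'(Coord n, ℂ), IsOscillatoryIntegral F B T ∧
      Distribution.dsupport T = signCone n (lowIdx t μ) (highIdx t μ) := by
  choose a ha using hint
  -- For an integer, a ≥ 0 means a > -1; this is the source of the + 1 in t = D/2 + 1.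
  have ha0 (k : Fin n) : 0 ≤ a k ↔ μ k < t := by
    rw [← Int.sub_one_lt_iff, ← Int.cast_lt (R := ℝ), ht]
    push_cast
    rw [ha]
    constructor <;> intro _ <;> linarith
  have hb0 (k : Fin n) : 0 ≤ D - a k ↔ -t < μ k := by
    rw [← Int.sub_one_lt_iff, ← Int.cast_lt (R := ℝ), ht]
    push_cast
    rw [ha]
    constructor <;> intro _ <;> linarith
  obtain ⟨T, hT, hs⟩ := exists_isOscillatoryIntegral_dsupport hc (a := a) (b := fun k => D - a k)
    (fun k => by
      rw [ha0, hb0]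
      exact (lt_or_ge (μ k) t).imp_right (hdisj k)) (F := F)
    (fun x => by
      rw [hF, cMinusPow]
      push_cast
      rw [← Finset.prod_mul_distrib]
      refine Finset.prod_congr rfl fun k _ => ?_
      rw [← cMinus_cpow_mul (ha k), Pi.neg_apply]
      push_cast
      rfl) hB
  refine ⟨T, hT, hs.trans ?_⟩
  ext y
  simp only [signCone, Set.mem_ofPred_eq]
  refine forall_congr' fun k => ?_
  have hl := mem_lowIdx_iff hμ t k
  have hh := highIdx_le_iff hμ t k
  -- Not both exponents are negative at k, so the segment k < `lowIdx` and the tail `highIdx` ≤ k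
  -- are disjoint.
  have hd := hdisj k
  rw [ha0, hb0]
  rw [← not_le] at hd
  rw [← not_le, ← not_le, ← hl, ← hh]
  rw [← hl, ← hh] at hd
  constructor
  · rintro ⟨h1, h2⟩
    exact ⟨fun h => h1 fun h' => hd h' h,
      fun h => le_antisymm (h2 (by omega)) (h1 (by omega)), fun h => h2 (hd h)⟩
  · rintro ⟨h1, h2, h3⟩
    refine ⟨fun h => ?_, fun h => ?_⟩
    · rcases lt_or_ge (k : ℕ) (lowIdx t μ) with h' | h'
      · exact h1 h'
      · exact (h2 ⟨h', not_le.mp h⟩).ge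
    · rcases le_or_gt (highIdx t μ) (k : ℕ) with h' | h'
      · exact h3 h'
      · exact (h2 ⟨not_lt.mp h, h'⟩).le

end Kernels

end SupportProp

namespace SupportProp

/-! ### Explicit ρ and μ' -/

section Roots

variable {n : ℕ}

lemma sum_sum_Ioi_eVec_left (k : Fin n) :
    (∑ i : Fin n, ∑ _j ∈ Finset.Ioi i, eVec i k) = (n : ℝ) - 1 - k := by
  have h (i : Fin n) : (∑ _j ∈ Finset.Ioi i, eVec i k) =
      if k = i then ((n : ℝ) - 1 - k) else 0 := by
    rw [Finset.sum_const, Fin.card_Ioi, eVec, Pi.single_apply]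
    split_ifs with hi
    · subst hi
      have := k.2
      rw [nsmul_eq_mul, mul_one, Nat.cast_sub (by omega), Nat.cast_sub (by omega)]
      simp
    · simp
  simp [h]

lemma sum_sum_Ioi_eVec_right (k : Fin n) :
    (∑ i : Fin n, ∑ j ∈ Finset.Ioi i, eVec j k) = (k : ℝ) := by
  have h (i : Fin n) : (∑ j ∈ Finset.Ioi i, eVec j k) = if i < k then (1 : ℝ) else 0 := by
    simp only [eVec, Pi.single_apply]
    rw [Finset.sum_ite_eq]
    simp
  simp only [h]
  rw [Finset.sum_ite, Finset.sum_const, Finset.sum_const_zero]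
  have : (Finset.univ.filter fun i : Fin n => i < k) = Finset.Iio k := by ext; simp
  simp [this]

lemma sum_eVec (k : Fin n) : (∑ i : Fin n, eVec i k) = (1 : ℝ) := by
  simp [eVec, Pi.single_apply]

lemma Unitary.rho_apply (k : Fin n) : Unitary.rho n k = ((n : ℝ) - 1) / 2 - k := by
  simp only [Unitary.rho, Pi.smul_apply, Finset.sum_apply, Pi.sub_apply, smul_eq_mul,
    Finset.sum_sub_distrib, sum_sum_Ioi_eVec_left, sum_sum_Ioi_eVec_right]
  ring

lemma Orthogonal.rhoEven_apply (k : Fin n) : Orthogonal.rhoEven n k = (n : ℝ) - 1 - k := by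
  simp only [Orthogonal.rhoEven, Pi.smul_apply, Finset.sum_apply, Pi.sub_apply, Pi.add_apply,
    smul_eq_mul, Finset.sum_add_distrib, Finset.sum_sub_distrib, sum_sum_Ioi_eVec_left,
    sum_sum_Ioi_eVec_right]
  ring

lemma Orthogonal.rhoOdd_apply (k : Fin n) : Orthogonal.rhoOdd n k = (n : ℝ) - 1 / 2 - k := by
  simp only [Orthogonal.rhoOdd, Pi.add_apply, Orthogonal.rhoEven_apply, Pi.smul_apply,
    Finset.sum_apply, sum_eVec, smul_eq_mul]
  ring

lemma Quaternionic.rho_apply (k : Fin n) : Quaternionic.rho n k = (n : ℝ) - k := by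
  simp only [Quaternionic.rho, Pi.smul_apply, Finset.sum_apply, Pi.sub_apply, Pi.add_apply,
    smul_eq_mul, Finset.sum_add_distrib, Finset.sum_sub_distrib, sum_sum_Ioi_eVec_left,
    sum_sum_Ioi_eVec_right, ← Finset.mul_sum, sum_eVec]
  ring

lemma val_rev_cast (k : Fin n) : ((Fin.rev k : Fin n) : ℝ) = (n : ℝ) - 1 - k := by
  rw [Fin.val_rev, Nat.cast_sub k.2]
  push_cast
  ring

lemma Unitary.muPrime_apply (p q : ℕ) (ν : Fin n → ℤ) (k : Fin n) :
    Unitary.muPrime p q ν k = ν k.rev + ((q : ℝ) - p + 1 - n) / 2 + k := by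
  rw [Unitary.muPrime, reversed, Unitary.rho_apply, val_rev_cast]
  ring

lemma Orthogonal.muPrimeEven_apply (ν : Fin n → ℕ) (k : Fin n) :
    Orthogonal.muPrimeEven ν k = ν k.rev + k := by
  rw [Orthogonal.muPrimeEven, reversed, Orthogonal.rhoEven_apply, val_rev_cast]
  ring

lemma Orthogonal.muPrimeOdd_apply (ν : Fin n → ℕ) (k : Fin n) :
    Orthogonal.muPrimeOdd ν k = ν k.rev + k + 1 / 2 := by
  rw [Orthogonal.muPrimeOdd, reversed, Orthogonal.rhoOdd_apply, val_rev_cast]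
  ring

lemma Quaternionic.muPrime_apply (ν : Fin n → ℕ) (k : Fin n) :
    Quaternionic.muPrime ν k = ν k.rev + k + 1 := by
  rw [Quaternionic.muPrime, reversed, Quaternionic.rho_apply, val_rev_cast]
  ring

end Roots

/-! ### The function ch on the Cartan subalgebras -/

section Determinants

open Matrix

/-- For X = -1 + iY the real matrix is minus a block matrix with identity diagonal blocks. Its size
is even, so the sign drops out, and the Schur complement is 1 + Y². -/
lemma det_realify_of_re_eq {ι : Type*} [Fintype ι] [DecidableEq ι] {X : Matrix ι ι ℂ}
    (h : X.map Complex.re = -1) : (realify X).det = (1 + X.map Complex.im * X.map Complex.im).det := by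
  have e : realify X = -fromBlocks 1 (X.map Complex.im) (-(X.map Complex.im)) 1 := by
    rw [realify, h, fromBlocks_neg, neg_neg]
  rw [e, det_neg, det_fromBlocks_one₁₁]
  simp [← two_mul]

variable {n : ℕ}

lemma diagonal_sq_add_one (x : Fin n → ℝ) :
    (1 + diagonal x * diagonal x : Matrix (Fin n) (Fin n) ℝ) = diagonal fun k => 1 + x k ^ 2 := by
  rw [diagonal_mul_diagonal, ← diagonal_one, diagonal_add]
  simp [sq]

lemma sqrt_abs_prod (x : Fin n → ℝ) :
    Real.sqrt |∏ k, (1 + x k ^ 2)| = ∏ k, Real.sqrt (1 + x k ^ 2) := by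
  rw [abs_of_nonneg (Finset.prod_nonneg fun k _ => by positivity),
    Real.sqrt_prod _ fun k _ => by positivity]

lemma Unitary.ch_cartan (x : Coord n) :
    Unitary.ch (Unitary.cartan x) = ∏ k, Real.sqrt (1 + x k ^ 2) := by
  have hre : (Unitary.cartan x - 1).map Complex.re = -1 := by
    ext i j
    rcases eq_or_ne i j with rfl | h
    · simp [Unitary.cartan]
    · simp [Unitary.cartan, h]
  have him : (Unitary.cartan x - 1).map Complex.im = diagonal fun k => x k := by
    ext i j
    rcases eq_or_ne i j with rfl | h
    · simp [Unitary.cartan]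
    · simp [Unitary.cartan, h]
  rw [Unitary.ch, det_realify_of_re_eq hre, him, diagonal_sq_add_one, det_diagonal, sqrt_abs_prod]

lemma Orthogonal.det_cartanEven_sub_one (x : Coord n) :
    (Orthogonal.cartanEven x - 1).det = ∏ k, (1 + x k ^ 2) := by
  rw [Orthogonal.cartanEven, ← blockDiagonal_one, ← blockDiagonal_sub, det_blockDiagonal]
  refine Finset.prod_congr rfl fun k _ => ?_
  simp [det_fin_two]
  ring

lemma Orthogonal.ch_cartanEven (x : Coord n) :
    Orthogonal.ch (Orthogonal.cartanEven x) = ∏ k, Real.sqrt (1 + x k ^ 2) := by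
  rw [Orthogonal.ch, Orthogonal.det_cartanEven_sub_one, sqrt_abs_prod]

lemma Orthogonal.ch_cartanOdd (x : Coord n) :
    Orthogonal.ch (Orthogonal.cartanOdd x) = ∏ k, Real.sqrt (1 + x k ^ 2) := by
  have e : Orthogonal.cartanOdd x - 1 = fromBlocks (Orthogonal.cartanEven x - 1) 0 0 (-1) := by
    rw [Orthogonal.cartanOdd, ← fromBlocks_one, sub_eq_add_neg, fromBlocks_neg, fromBlocks_add]
    simp [sub_eq_add_neg]
  rw [Orthogonal.ch, e, det_fromBlocks_zero₂₁, Orthogonal.det_cartanEven_sub_one, det_neg]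
  simp [sqrt_abs_prod]

lemma Quaternionic.cartan_apply_self (x : Coord n) (i : Fin n) :
    (Quaternionic.cartan x i i).re = 0 ∧ (Quaternionic.cartan x i i).imI = x i ∧
      (Quaternionic.cartan x i i).imJ = 0 ∧ (Quaternionic.cartan x i i).imK = 0 := by
  have h : Quaternionic.cartan x i i = ⟨0, x i, 0, 0⟩ := diagonal_apply_eq _ _
  rw [h]
  exact ⟨rfl, rfl, rfl, rfl⟩

lemma Quaternionic.cartan_apply_ne (x : Coord n) {i j : Fin n} (h : i ≠ j) :
    Quaternionic.cartan x i j = 0 := diagonal_apply_ne _ h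

/-- Each quaternionic coordinate contributes both ixₖ and -ixₖ, hence the square. -/
lemma Quaternionic.ch_cartan (x : Coord n) :
    Quaternionic.ch (Quaternionic.cartan x) = ∏ k, Real.sqrt (1 + x k ^ 2) ^ 2 := by
  have hre : (Quaternionic.complexify (Quaternionic.cartan x - 1)).map Complex.re = -1 := by
    rw [← fromBlocks_one, fromBlocks_neg, Quaternionic.complexify, fromBlocks_map]
    congr 1 <;> ext i j <;> by_cases h : i = j <;>
      simp [h, Quaternionic.cartan_apply_self, Quaternionic.cartan_apply_ne, Quaternionic.alpha,
        Quaternionic.beta]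
  have him : (Quaternionic.complexify (Quaternionic.cartan x - 1)).map Complex.im =
      fromBlocks (diagonal fun k => x k) 0 0 (diagonal fun k => -x k) := by
    rw [Quaternionic.complexify, fromBlocks_map]
    congr 1 <;> ext i j <;> by_cases h : i = j <;>
      simp [h, Quaternionic.cartan_apply_self, Quaternionic.cartan_apply_ne, Quaternionic.alpha,
        Quaternionic.beta]
  rw [Quaternionic.ch, det_realify_of_re_eq hre, him, fromBlocks_multiply, ← fromBlocks_one,
    fromBlocks_add]
  simp only [Matrix.mul_zero, Matrix.zero_mul, add_zero, zero_add, diagonal_sq_add_one,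
    det_fromBlocks_zero₂₁, det_diagonal, neg_sq]
  rw [← sq, abs_of_nonneg (sq_nonneg _), Real.sqrt_sq (Finset.prod_nonneg fun k _ => by positivity)]
  exact Finset.prod_congr rfl fun k _ => (Real.sq_sqrt (by positivity)).symm

end Determinants

end SupportProp

namespace SupportProp

variable {n : ℕ}

/-! ### The pair (U(n), U(p,q)): index bounds and moment map images -/

namespace Unitary

open Matrix

lemma form_eq (κ : ℝ) (x y : Coord n) : form κ x y = -(κ * ∑ k, x k * y k) := by
  simp [form, cartan, trace, Finset.mul_sum]

lemma kernel_eq (p q : ℕ) (ν : Fin n → ℤ) (x : Coord n) :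
    kernel p q ν x = cMinusPow (fun k => Complex.I * (x k : ℂ)) (-muPrime p q ν) *
      ((∏ k, Real.sqrt (1 + x k ^ 2) ^ ((p : ℤ) + q - n - 1) : ℝ) : ℂ) := by
  rw [kernel, ch_cartan, Finset.prod_zpow]
  simp [cartan]

lemma monotone_muPrime (p q : ℕ) {ν : Fin n → ℤ} (hν : Antitone ν) :
    Monotone (muPrime p q ν) := by
  intro i j hij
  rw [muPrime_apply, muPrime_apply]
  have h1 : (ν i.rev : ℝ) ≤ ν j.rev := by exact_mod_cast hν (Fin.rev_le_rev.mpr hij)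
  have h2 : ((i : ℕ) : ℝ) ≤ (j : ℕ) := by exact_mod_cast hij
  linarith

lemma cartan_injective : Function.Injective (cartan : Coord n → Matrix (Fin n) (Fin n) ℂ) := by
  intro x y h
  ext k
  have := congrFun (diagonal_injective h) k
  simpa using this

/-- Otherwise the first index not counted by `mMin` has ν > n - q - `mMin` - 1 ≥ 0. By antitonicity
more than q of the ν are then positive. -/
lemma le_mMin_add [NeZero n] {p q : ℕ} {ν : Fin n → ℤ} (hν : IsWeight p q ν) :
    n ≤ mMin p q ν + q := by
  by_contra! h
  let k : Fin n := ⟨mMin p q ν, by omega⟩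
  have h1 := (mem_lowIdx_iff (monotone_muPrime p q hν.1) (threshold n p q) k).not.mp
    (lt_irrefl (mMin p q ν))
  rw [muPrime_apply, threshold, not_le] at h1
  have h2 : ((n : ℤ) - q - mMin p q ν : ℤ) - 1 < ν k.rev := by
    rw [← Int.cast_lt (R := ℝ)]
    push_cast
    have : ((k : ℕ) : ℝ) = mMin p q ν := rfl
    linarith
  have h3 : Finset.Iic k.rev ⊆ Finset.univ.filter fun a => 0 < ν a := by
    intro a ha
    have := hν.1 (Finset.mem_Iic.mp ha)
    simp only [Finset.mem_filter, Finset.mem_univ, true_and]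
    omega
  have h4 := (Finset.card_le_card h3).trans hν.2.1
  rw [Fin.card_Iic, Fin.val_rev] at h4
  have : (k : ℕ) = mMin p q ν := rfl
  omega

lemma mMax_le [NeZero n] {p q : ℕ} {ν : Fin n → ℤ} (hν : IsWeight p q ν) :
    mMax p q ν ≤ min p n := by
  refine le_min ?_ (highIdx_le _ _)
  by_contra! h
  have hn : mMax p q ν ≤ n := highIdx_le _ _
  -- At this index μ' < t reads exactly ν < 0, so p + 1 of the ν would be negative.
  let k : Fin n := ⟨p, by omega⟩
  have h1 := (highIdx_le_iff (monotone_muPrime p q hν.1) (threshold n p q) k).not.mp (not_le.mpr h)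
  rw [muPrime_apply, threshold, not_le] at h1
  have h2 : ν k.rev < 0 := by
    rw [← Int.cast_lt (R := ℝ)]
    push_cast
    have : ((k : ℕ) : ℝ) = p := rfl
    linarith
  have h3 : Finset.Ici k.rev ⊆ Finset.univ.filter fun a => ν a < 0 := by
    intro a ha
    have := hν.1 (Finset.mem_Ici.mp ha)
    simp only [Finset.mem_filter, Finset.mem_univ, true_and]
    omega
  have h4 := (Finset.card_le_card h3).trans hν.2.2
  rw [Fin.card_Ici, Fin.val_rev] at h4
  have : (k : ℕ) = p := rfl
  omega

lemma threshold_pos {p q : ℕ} (h : n ≤ p + q) : 0 < threshold n p q := by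
  have : (n : ℝ) ≤ p + q := by exact_mod_cast h
  rw [threshold]
  linarith

lemma mMin_le_mMax [NeZero n] {p q : ℕ} {ν : Fin n → ℤ} (hν : Antitone ν) (hn : n ≤ p + q) :
    mMin p q ν ≤ mMax p q ν := by
  by_contra! h
  have hl : mMin p q ν ≤ n := lowIdx_le _ _
  let k : Fin n := ⟨mMax p q ν, by omega⟩
  have h1 := (mem_lowIdx_iff (monotone_muPrime p q hν) (threshold n p q) k).mp h
  have h2 := (highIdx_le_iff (monotone_muPrime p q hν) (threshold n p q) k).mp le_rfl
  have := threshold_pos hn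
  linarith

lemma sum_smul_u (p q m : ℕ) (c : Fin n → ℝ) :
    ∑ j, c j • u p q m j = fromBlocks 0 (∑ j, c j • uBlock p q m j)
      (∑ j, c j • uBlock p q m j)ᵀ 0 := by
  have h (j : Fin n) : c j • u p q m j =
      fromBlocks 0 (c j • uBlock p q m j) (c j • uBlock p q m j)ᵀ 0 := by
    rw [u, fromBlocks_smul, smul_zero, smul_zero, transpose_smul]
  simp only [h]
  ext (i | i) (j | j) <;> simp [Matrix.sum_apply]

lemma sum_smul_uBlock_apply (p q m : ℕ) (c : Fin n → ℝ) (i : Fin n) (k : Fin (p + q)) :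
    (∑ j, c j • uBlock p q m j) i k = if (k : ℕ) = pos n p q m i then c i * phase m i else 0 := by
  rw [Matrix.sum_apply, Finset.sum_eq_single i]
  · simp [uBlock]
  · intro j _ hj
    simp [uBlock, hj.symm]
  · simp

lemma phase_sq (m j : ℕ) : phase m j ^ 2 = if j < m then Complex.I else -Complex.I := by
  rw [phase]
  split_ifs
  · rw [← Complex.exp_nat_mul]
    refine Eq.trans ?_ Complex.exp_pi_div_two_mul_I
    congr 1
    push_cast
    ring
  · rw [← Complex.exp_nat_mul, ← Complex.exp_neg_pi_div_two_mul_I]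
    congr 1
    push_cast
    ring

/-- The squared phases are ±i, and distinct j are paired with distinct vectors of V₁ because n ≤ p +
q; hence the off-diagonal entries vanish. -/
lemma tau_sum_smul_u {p q m : ℕ} (hn : n ≤ p + q) (c : Fin n → ℝ) :
    tau (∑ j, c j • u p q m j) =
      cartan (WithLp.toLp 2 fun j : Fin n => if (j : ℕ) < m then c j ^ 2 else -c j ^ 2) := by
  rw [tau, sum_smul_u, fromBlocks_multiply, toBlocks_fromBlocks₁₁, Matrix.zero_mul, zero_add]
  ext i l
  rw [mul_apply]
  simp only [transpose_apply, sum_smul_uBlock_apply]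
  have hpos (j : Fin n) : pos n p q m j < p + q := by
    rw [pos]
    split_ifs <;> omega
  rcases eq_or_ne i l with rfl | hil
  · rw [Finset.sum_eq_single ⟨pos n p q m i, hpos i⟩]
    · have := phase_sq m i
      simp only [if_true, cartan, diagonal_apply_eq]
      rw [mul_mul_mul_comm, ← sq (phase m i), this]
      split_ifs <;> push_cast <;> ring
    · intro k _ hk
      rw [if_neg fun h => hk (Fin.ext h), zero_mul]
    · simp
  · rw [cartan, diagonal_apply_ne _ hil]
    refine Finset.sum_eq_zero fun k _ => ?_
    have : pos n p q m i ≠ pos n p q m l := by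
      have := Fin.val_ne_of_ne hil
      simp only [pos]
      split_ifs <;> omega
    split_ifs with h1 h2
    · exact absurd (h1.symm.trans h2) this
    all_goals simp

lemma tau_image_h1 {p q : ℕ} (hn : n ≤ p + q) (m : ℕ) :
    tau '' (h1 n p q m : Set (EndV n p q)) = cartan '' signCone n m m := by
  ext X
  constructor
  · rintro ⟨w, hw, rfl⟩
    obtain ⟨c, rfl⟩ := (Submodule.mem_span_range_iff_exists_fun ℝ).mp hw
    refine ⟨_, fun k => ⟨fun h => ?_, fun h => ?_, fun h => ?_⟩, (tau_sum_smul_u hn c).symm⟩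
    · simp only [h, if_true]
      positivity
    · omega
    · simp only [not_lt.mpr h, if_false]
      nlinarith [sq_nonneg (c k)]
  · rintro ⟨y, hy, rfl⟩
    refine ⟨_, (Submodule.mem_span_range_iff_exists_fun ℝ).mpr ⟨fun j => Real.sqrt |y j|, rfl⟩, ?_⟩
    rw [tau_sum_smul_u hn]
    congr 1
    ext k
    simp only [Real.sq_sqrt (abs_nonneg _)]
    split_ifs with h
    · exact abs_of_nonneg ((hy k).1 h)
    · rw [abs_of_nonpos ((hy k).2.2 (not_lt.mp h)), neg_neg]

/-- The two extreme cones m = r and m = s already cut out the intersection: between them a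
coordinate is both ≤ 0 and ≥ 0. -/
lemma iInter_signCone {r s : ℕ} (hrs : r ≤ s) :
    ⋂ m ∈ Set.Icc r s, signCone n m m = signCone n r s := by
  ext y
  simp only [Set.mem_iInter, signCone, Set.mem_ofPred_eq]
  constructor
  · intro h k
    have hr := h r ⟨le_rfl, hrs⟩ k
    have hs := h s ⟨hrs, le_rfl⟩ k
    exact ⟨hr.1, fun hk => le_antisymm (hr.2.2 hk.1) (hs.1 hk.2), hs.2.2⟩
  · intro h m hm k
    refine ⟨fun hk => ?_, fun hk => by omega, fun hk => ?_⟩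
    · rcases lt_or_ge (k : ℕ) r with h' | h'
      · exact (h k).1 h'
      · exact ((h k).2.1 ⟨h', hk.trans_le hm.2⟩).ge
    · rcases lt_or_ge (k : ℕ) s with h' | h'
      · exact ((h k).2.1 ⟨hm.1.trans hk, h'⟩).le
      · exact (h k).2.2 h'

lemma iInter_tau_image {p q r s : ℕ} (hn : n ≤ p + q) (hrs : r ≤ s) :
    ⋂ m ∈ Set.Icc r s, tau '' (h1 n p q m : Set (EndV n p q)) = cartan '' signCone n r s := by
  simp only [tau_image_h1 hn]
  -- Image and intersection commute because `cartan` is injective and the index set is nonempty.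
  rw [← iInter_signCone hrs, Set.InjOn.image_biInter_eq ⟨r, le_rfl, hrs⟩ cartan_injective.injOn]

theorem exists_support [NeZero n] {p q : ℕ} {κ : ℝ} {ν : Fin n → ℤ} (hn : n ≤ p + q) (hκ : 0 < κ)
    (hν : Antitone ν) :
    ∃ T : 𝓢'(Coord n, ℂ), IsOscillatoryIntegral (kernel p q ν) (form κ) T ∧
      Distribution.dsupport T = signCone n (mMin p q ν) (mMax p q ν) := by
  have ht := threshold_pos hn
  refine exists_isOscillatoryIntegral_dsupport_eq_signCone hκ (D := (p : ℤ) + q - n - 1)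
    (monotone_muPrime p q hν) (fun k => ⟨(p : ℤ) - 1 - ν k.rev - (k : ℕ), ?_⟩) ?_
    (fun k h => by linarith) (kernel_eq p q ν) (form_eq κ)
  · rw [muPrime_apply]
    push_cast
    ring
  · rw [threshold]
    push_cast
    ring

end Unitary

/-! ### The pairs (O(2n), Sp(2m)) and (O(2n+1), Sp(2m)) -/

namespace Orthogonal

open Matrix

/-- The factor 2 comes from tr(Hₖ²) = -2. -/
lemma formEven_eq (κ : ℝ) (x y : Coord n) :
    formEven κ x y = -(2 * κ * ∑ k, x k * y k) := by
  rw [formEven, cartanEven, cartanEven, ← blockDiagonal_mul, trace_blockDiagonal]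
  simp only [Matrix.smul_mul, Matrix.mul_smul, trace_smul, trace_fin_two]
  simp [Finset.mul_sum, ← Finset.sum_neg_distrib]
  refine Finset.sum_congr rfl fun k _ => ?_
  ring

lemma formOdd_eq (κ : ℝ) (x y : Coord n) : formOdd κ x y = -(2 * κ * ∑ k, x k * y k) := by
  rw [← formEven_eq, formOdd, formEven, cartanOdd, cartanOdd, fromBlocks_multiply]
  simp [trace, Fintype.sum_sum_type]

lemma e_cartanEven (x : Coord n) : e (cartanEven x) = fun k => Complex.I * (x k : ℂ) := by
  ext k
  simp [e, cartanEven, blockDiagonal_apply]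

lemma kernelEven_eq (m : ℕ) (ν : Fin n → ℕ) (x : Coord n) :
    kernelEven m ν x = cMinusPow (fun k => Complex.I * (x k : ℂ)) (-muPrimeEven ν) *
      ((∏ k, Real.sqrt (1 + x k ^ 2) ^ (2 * (m : ℤ) - 2 * n) : ℝ) : ℂ) := by
  rw [kernelEven, ch_cartanEven, Finset.prod_zpow, e_cartanEven]

lemma kernelOdd_eq (m : ℕ) (ν : Fin n → ℕ) (x : Coord n) :
    kernelOdd m ν x = cMinusPow (fun k => Complex.I * (x k : ℂ)) (-muPrimeOdd ν) *
      ((∏ k, Real.sqrt (1 + x k ^ 2) ^ (2 * (m : ℤ) - 2 * n - 1) : ℝ) : ℂ) := by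
  rw [kernelOdd, ch_cartanOdd, Finset.prod_zpow, cartanOdd, toBlocks_fromBlocks₁₁, e_cartanEven]

lemma monotone_rev_add {ν : Fin n → ℕ} (hν : Antitone ν) :
    Monotone fun k : Fin n => ((ν k.rev : ℝ) + ((k : ℕ) : ℝ)) := by
  intro i j hij
  have h1 : (ν i.rev : ℝ) ≤ ν j.rev := by exact_mod_cast hν (Fin.rev_le_rev.mpr hij)
  have h2 : ((i : ℕ) : ℝ) ≤ (j : ℕ) := by exact_mod_cast hij
  exact add_le_add h1 h2

theorem exists_support_even [NeZero n] {m : ℕ} {κ : ℝ} {ν : Fin n → ℕ} (hn : n ≤ m) (hκ : 0 < κ)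
    (hν : Antitone ν) :
    ∃ T : 𝓢'(Coord n, ℂ), IsOscillatoryIntegral (kernelEven m ν) (formEven κ) T ∧
      Distribution.dsupport T = signCone n (lowIdx ((m : ℝ) - n + 1) (muPrimeEven ν))
        (highIdx ((m : ℝ) - n + 1) (muPrimeEven ν)) := by
  have hn' : (n : ℝ) ≤ m := by exact_mod_cast hn
  refine exists_isOscillatoryIntegral_dsupport_eq_signCone (by positivity : 0 < 2 * κ)
    (D := 2 * (m : ℤ) - 2 * n) (fun i j hij => ?_)
    (fun k => ⟨(m : ℤ) - n - ν k.rev - (k : ℕ), ?_⟩) ?_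
    (fun k h => by linarith) (kernelEven_eq m ν) (formEven_eq κ)
  · simpa only [muPrimeEven_apply] using monotone_rev_add hν hij
  · rw [muPrimeEven_apply]
    push_cast
    ring
  · push_cast
    ring

theorem exists_support_odd [NeZero n] {m : ℕ} {κ : ℝ} {ν : Fin n → ℕ} (hn : n ≤ m) (hκ : 0 < κ)
    (hν : Antitone ν) :
    ∃ T : 𝓢'(Coord n, ℂ), IsOscillatoryIntegral (kernelOdd m ν) (formOdd κ) T ∧
      Distribution.dsupport T = signCone n (lowIdx ((m : ℝ) - n + 1 / 2) (muPrimeOdd ν))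
        (highIdx ((m : ℝ) - n + 1 / 2) (muPrimeOdd ν)) := by
  have hn' : (n : ℝ) ≤ m := by exact_mod_cast hn
  refine exists_isOscillatoryIntegral_dsupport_eq_signCone (by positivity : 0 < 2 * κ)
    (D := 2 * (m : ℤ) - 2 * n - 1) (fun i j hij => ?_)
    (fun k => ⟨(m : ℤ) - n - 1 - ν k.rev - (k : ℕ), ?_⟩) ?_
    (fun k h => by linarith) (kernelOdd_eq m ν) (formOdd_eq κ)
  · simpa only [muPrimeOdd_apply] using add_le_add_left (monotone_rev_add hν hij) (1 / 2)
  · rw [muPrimeOdd_apply]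
    push_cast
    ring
  · push_cast
    ring

end Orthogonal

/-! ### The pair (U(n, ℍ), O*(m, ℍ)) -/

namespace Quaternionic

open Matrix

lemma cartan_eq_diagonal (x : Coord n) : cartan x = diagonal fun k => cartan x k k := by
  ext1 i j
  rcases eq_or_ne i j with rfl | h
  · rw [diagonal_apply_eq]
  · rw [cartan_apply_ne x h, diagonal_apply_ne _ h]

lemma form_eq (κ : ℝ) (x y : Coord n) : form κ x y = -(κ * ∑ k, x k * y k) := by
  have h : ((cartan x * cartan y).trace).re = -∑ k, x k * y k := by
    have hd : cartan x * cartan y = diagonal fun k => cartan x k k * cartan y k k := by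
      rw [← diagonal_mul_diagonal, ← cartan_eq_diagonal, ← cartan_eq_diagonal]
    have hre : ∀ s : Finset (Fin n), (∑ k ∈ s, cartan x k k * cartan y k k).re =
        ∑ k ∈ s, (cartan x k k * cartan y k k).re := fun s => by
      classical
      induction s using Finset.induction_on with
      | empty => simp
      | insert a s ha ih => rw [Finset.sum_insert ha, Finset.sum_insert ha, Quaternion.re_add, ih]
    rw [hd, trace_diagonal, hre, ← Finset.sum_neg_distrib]
    refine Finset.sum_congr rfl fun k _ => ?_
    obtain ⟨h1, h2, h3, h4⟩ := cartan_apply_self x k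
    obtain ⟨h1', h2', h3', h4'⟩ := cartan_apply_self y k
    rw [Quaternion.re_mul, h1, h2, h3, h4, h2']
    ring
  rw [form, h]
  ring

lemma kernel_eq (m : ℕ) (ν : Fin n → ℕ) (x : Coord n) :
    kernel m ν x = cMinusPow (fun k => Complex.I * (x k : ℂ)) (-muPrime ν) *
      ((∏ k, Real.sqrt (1 + x k ^ 2) ^ (2 * ((m : ℤ) - n - 1)) : ℝ) : ℂ) := by
  have h : (fun k => alpha (cartan x k k)) = fun k => Complex.I * (x k : ℂ) := by
    ext k
    obtain ⟨h1, h2, -, -⟩ := cartan_apply_self x k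
    apply Complex.ext <;> simp [alpha, h1, h2]
  rw [kernel, ch_cartan, h, ← Finset.prod_zpow]
  simp only [_root_.zpow_mul, zpow_ofNat]

theorem exists_support [NeZero n] {m : ℕ} {κ : ℝ} {ν : Fin n → ℕ} (hn : n ≤ m) (hκ : 0 < κ)
    (hν : Antitone ν) :
    ∃ T : 𝓢'(Coord n, ℂ), IsOscillatoryIntegral (kernel m ν) (form κ) T ∧
      Distribution.dsupport T = signCone n (lowIdx ((m : ℝ) - n) (muPrime ν))
        (highIdx ((m : ℝ) - n) (muPrime ν)) := by
  have hn' : (n : ℝ) ≤ m := by exact_mod_cast hn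
  refine exists_isOscillatoryIntegral_dsupport_eq_signCone hκ
    (D := 2 * ((m : ℤ) - n - 1)) (fun i j hij => ?_)
    (fun k => ⟨(m : ℤ) - n - 2 - ν k.rev - (k : ℕ), ?_⟩) ?_
    (fun k h => ?_) (kernel_eq m ν) (form_eq κ)
  · simpa only [muPrime_apply] using
      add_le_add_left (Orthogonal.monotone_rev_add hν hij) 1
  · rw [muPrime_apply]
    push_cast
    ring
  · push_cast
    ring
  -- For m = n the threshold is 0, so its positivity is not available; μ' > 0 excludes two negative
  -- exponents instead.
  · have : 0 < muPrime ν k := by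
      rw [muPrime_apply]
      positivity
    linarith

end Quaternionic

end SupportProp

open SupportProp in
theorem mainTheorem7 :
    -- the pair `(U(n), U(p,q))`
    (∀ (n p q : ℕ) [NeZero n] (κ : ℝ) (ν : Fin n → ℤ),
      n ≤ p + q → 0 < κ → Unitary.IsWeight p q ν →
        (n ≤ Unitary.mMin p q ν + q ∧ Unitary.mMin p q ν ≤ Unitary.mMax p q ν ∧
          Unitary.mMax p q ν ≤ min p n) ∧
        ∃ T : 𝓢'(Coord n, ℂ),
          IsOscillatoryIntegral (Unitary.kernel p q ν) (Unitary.form κ) T ∧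
          Unitary.cartan '' Distribution.dsupport T =
            ⋂ m' ∈ Set.Icc (Unitary.mMin p q ν) (Unitary.mMax p q ν),
              Unitary.tau '' (Unitary.h1 n p q m' : Set (Unitary.EndV n p q)) ∧
          Unitary.cartan '' Distribution.dsupport T =
            Unitary.cartan '' signCone n (Unitary.mMin p q ν) (Unitary.mMax p q ν)) ∧
    -- the pair `(O(2n), Sp(2m))`
    (∀ (n m : ℕ) [NeZero n] (κ : ℝ) (ν : Fin n → ℕ), n ≤ m → 0 < κ → Antitone ν →
        ∃ T : 𝓢'(Coord n, ℂ),
          IsOscillatoryIntegral (Orthogonal.kernelEven m ν) (Orthogonal.formEven κ) T ∧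
          Orthogonal.cartanEven '' Distribution.dsupport T =
            Orthogonal.cartanEven ''
              signCone n (lowIdx ((m : ℝ) - n + 1) (Orthogonal.muPrimeEven ν))
                (highIdx ((m : ℝ) - n + 1) (Orthogonal.muPrimeEven ν))) ∧
    -- the pair `(O(2n+1), Sp(2m))`
    (∀ (n m : ℕ) [NeZero n] (κ : ℝ) (ν : Fin n → ℕ), n ≤ m → 0 < κ → Antitone ν →
        ∃ T : 𝓢'(Coord n, ℂ),
          IsOscillatoryIntegral (Orthogonal.kernelOdd m ν) (Orthogonal.formOdd κ) T ∧
          Orthogonal.cartanOdd '' Distribution.dsupport T =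
            Orthogonal.cartanOdd ''
              signCone n (lowIdx ((m : ℝ) - n + 1 / 2) (Orthogonal.muPrimeOdd ν))
                (highIdx ((m : ℝ) - n + 1 / 2) (Orthogonal.muPrimeOdd ν))) ∧
    -- the pair `(U(n, ℍ), O*(m, ℍ))`
    (∀ (n m : ℕ) [NeZero n] (κ : ℝ) (ν : Fin n → ℕ), n ≤ m → 0 < κ → Antitone ν →
        ∃ T : 𝓢'(Coord n, ℂ),
          IsOscillatoryIntegral (Quaternionic.kernel m ν) (Quaternionic.form κ) T ∧
          Quaternionic.cartan '' Distribution.dsupport T =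
            Quaternionic.cartan ''
              signCone n (lowIdx ((m : ℝ) - n) (Quaternionic.muPrime ν))
                (highIdx ((m : ℝ) - n) (Quaternionic.muPrime ν))) := by
  refine ⟨fun n p q _ κ ν hn hκ hν => ?_, fun n m _ κ ν hn hκ hν => ?_,
    fun n m _ κ ν hn hκ hν => ?_, fun n m _ κ ν hn hκ hν => ?_⟩
  · have hle := Unitary.mMin_le_mMax hν.1 hn
    obtain ⟨T, hT, hs⟩ := Unitary.exists_support hn hκ hν.1
    refine ⟨⟨Unitary.le_mMin_add hν, hle, Unitary.mMax_le hν⟩, T, hT, ?_, by rw [hs]⟩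
    rw [hs, Unitary.iInter_tau_image hn hle]
  · obtain ⟨T, hT, hs⟩ := Orthogonal.exists_support_even hn hκ hν
    exact ⟨T, hT, by rw [hs]⟩
  · obtain ⟨T, hT, hs⟩ := Orthogonal.exists_support_odd hn hκ hν
    exact ⟨T, hT, by rw [hs]⟩
  · obtain ⟨T, hT, hs⟩ := Quaternionic.exists_support hn hκ hν
    exact ⟨T, hT, by rw [hs]⟩
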